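/- Let $X$ be a closed (compact, without boundary) almost complex orbifold of complex dimension $n$ (effective, Hausdorff, second countable), with almost complex structure $J$. For $p\in X$ let $G_p$ be its local group, i.e. the isotropy group of a point over $p$ in a uniformizing system $(V,G,\pi)$ around $p$; it acts complex linearly, by derivatives, on the tangent space $(T_p,J)\cong\mathbf C^n$ of $V$ at that point. Let $$\widetilde X=\{(p,(g)_{G_p}) : p\in X,\ g\in G_p\},$$ where $(g)_{G_p}$ is the conjugacy class of $g$ in $G_p$. For a uniformizing system $(V,G,\pi)$ and $g\in G$, each $x\in V^g=\{x\in V: gx=x\}$ determines a point $(\pi(x),(g))\in\widetilde X$ (identify the isotropy group of $x$ with $G_{\pi(x)}$ by a change of charts); give $\widetilde X$ the finest topology for which all these maps $V^g\to\widetilde X$ are continuous. If $g\in G_p$ has order $m_g$ and acts on $T_p$ in a suitable complex basis as $\mathrm{diag}(e^{2\pi i m_{1,g}/m_g},\dots,e^{2\pi i m_{n,g}/m_g})$ with integers $0\le m_{j,g}<m_g$, put $\iota(p,(g)_{G_p})=\sum_{j=1}^n m_{j,g}/m_g\in\mathbf Q$. Let $I(p,(g)_{G_p})=(p,(g^{-1})_{G_p})$.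 Consider the equivalence relation on $\widetilde X$ (that is, among the classes $(g)_{G_p}$) generated by declaring $(\pi(x),(g))$ and $(\pi(y),(g))$ equivalent whenever $(V,G,\pi)$ is a uniformizing system, $g\in G$, and $x,y$ lie in a connected subset of $V^g$. Let $T$ be the set of equivalence classes; write $(g)\in T$ for a class, and $X_{(g)}\subseteq\widetilde X$ for the set of points in it, with the subspace topology. Then: (0) $\widetilde X$ is the disjoint union of the sets $X_{(g)}$, $(g)\in T$, each of which is open in $\widetilde X$. Each $X_{(g)}$ is naturally a closed, connected, almost complex orbifold: it is compact, Hausdorff, second countable and connected, and it has an almost complex orbifold structure, of some complex dimension $\dim_{\mathbf C}X_{(g)}$, whose uniformizing systems are locally identified, by pseudo-holomorphic diffeomorphisms, with open subsets of the fixed point sets $V^g$ of uniformizing systems of $X$, so that the projection to $X_{(g)}$ becomes $x\mapsto(\pi(x),(g))$. The function $\iota$ is constant on each $X_{(g)}$, with value denoted $\iota_{(g)}$, and $I$ induces a map $(g)\mapsto(g^{-1})$ of $T$. (1) $\iota:\widetilde X\to\mathbf Q$ is integer-valued if and only if each $G_p$ is contained in $SL(n,\mathbf C)$, i.e. every $g\in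 G_p$ acts on $T_p$ with determinant $1$. (2) $\iota_{(g)}+\iota_{(g^{-1})}=\dim_{\mathbf C}X-\dim_{\mathbf C}X_{(g)}$ for all $(g)\in T$. (3) $\iota_{(g)}\ge 0$ for all $(g)\in T$, and $\iota_{(g)}=0$ if and only if $(g)$ is the class of $(1)_{G_p}$ for some $p\in X$. The elements $(1)_{G_p}$ and $(1)_{G_q}$ have the same class if and only if $p$ and $q$ lie in the same connected component of $X$; so, if $X$ is connected, $\iota_{(g)}=0$ if and only if $(g)=(1)$. -/

import Mathlib

open Set Filter Topology
open scoped ContDiff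

universe u

noncomputable section

namespace CROrbifold

/-- The model space `ℂⁿ`; smoothness is always smoothness over `ℝ`. -/
abbrev Cn (n : ℕ) : Type := EuclideanSpace ℂ (Fin n)

/-- A uniformizing system `(V, G, π)` in a space `X`: a connected open set `V ⊆ ℂⁿ` (`dom`), a finite
group `G` acting effectively on `V` by diffeomorphisms, and a map `π : V → X` (`proj`) which induces
a homeomorphism of `V / G` onto an open subset of `X`. The values of `act g` and `proj` outside
`dom` are irrelevant. -/
structure Chart (n : ℕ) (X : Type u) [TopologicalSpace X] where
  dom : Set (Cn n)
  isOpen_dom : IsOpen dom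
  isConnected_dom : IsConnected dom
  G : Type
  [group : Group G]
  [finite : Finite G]
  act : G → Cn n → Cn n
  act_mem : ∀ g, ∀ x ∈ dom, act g x ∈ dom
  act_one : ∀ x ∈ dom, act 1 x = x
  act_mul : ∀ g h, ∀ x ∈ dom, act (g * h) x = act g (act h x)
  act_smooth : ∀ g, ContDiffOn ℝ ∞ (act g) dom
  act_effective : ∀ g, (∀ x ∈ dom, act g x = x) → g = 1
  proj : Cn n → X
  proj_continuous : ContinuousOn proj dom
  proj_open : ∀ W ⊆ dom, IsOpen W → IsOpen (proj '' W)
  proj_eq_iff : ∀ x ∈ dom, ∀ y ∈ dom, proj x = proj y ↔ ∃ g, act g x = y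

attribute [instance] Chart.group Chart.finite

variable {n : ℕ} {X : Type u} [TopologicalSpace X]

/-- The fixed point set `V^g`. -/
def Chart.fix (c : Chart n X) (g : c.G) : Set (Cn n) := {x | x ∈ c.dom ∧ c.act g x = x}

/-- The isotropy group of a point of `V`. -/
def Chart.stab (c : Chart n X) {x : Cn n} (hx : x ∈ c.dom) : Subgroup c.G where
  carrier := {g | c.act g x = x}
  one_mem' := c.act_one x hx
  mul_mem' := by
    intro a b ha hb
    simp only [mem_ofPred_eq] at ha hb ⊢
    rw [c.act_mul a b x hx, hb, ha]
  inv_mem' := by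
    intro a ha
    simp only [mem_ofPred_eq] at ha ⊢
    have h := c.act_mul a⁻¹ a x hx
    rw [inv_mul_cancel, c.act_one x hx, ha] at h
    exact h.symm

/-- `φ` is a change of charts: a diffeomorphism between an open subset of the domain of `c` and an
open subset of the domain of `c'` that covers the identity of `X`. -/
structure IsTransition (c c' : Chart n X) (φ : OpenPartialHomeomorph (Cn n) (Cn n)) : Prop where
  source_subset : φ.source ⊆ c.dom
  target_subset : φ.target ⊆ c'.dom
  smooth : ContDiffOn ℝ ∞ φ φ.source
  smooth_symm : ContDiffOn ℝ ∞ φ.symm φ.target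
  proj_eq : ∀ x ∈ φ.source, c'.proj (φ x) = c.proj x

/-- A smooth (effective) orbifold structure of real dimension `2n` on `X`: `X` is Hausdorff and second
countable and is covered by uniformizing systems any two of which are related, near any two points
over the same point of `X`, by a change of charts. -/
structure Orbifold (n : ℕ) (X : Type u) [TopologicalSpace X] where
  t2 : T2Space X
  secondCountable : SecondCountableTopology X
  atlas : Set (Chart n X)
  cover : ∀ p : X, ∃ c : atlas, ∃ x ∈ c.1.dom, c.1.proj x = p
  compatible : ∀ c c' : atlas, ∀ x ∈ c.1.dom, ∀ x' ∈ c'.1.dom, c.1.proj x = c'.1.proj x' →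
    ∃ φ, IsTransition c.1 c'.1 φ ∧ x ∈ φ.source ∧ φ x = x'

namespace Orbifold

variable (O : Orbifold n X)

/-- A chosen uniformizing system around `p`. -/
def chartAt (p : X) : O.atlas := (O.cover p).choose

/-- A chosen point over `p` in the chosen uniformizing system around `p`. -/
def liftAt (p : X) : Cn n := (O.cover p).choose_spec.choose

lemma liftAt_mem (p : X) : O.liftAt p ∈ (O.chartAt p).1.dom :=
  (O.cover p).choose_spec.choose_spec.1

/-- The local group `G_p`. -/
def localGroup (p : X) : Subgroup (O.chartAt p).1.G := (O.chartAt p).1.stab (O.liftAt_mem p)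

/-- The set `X̃` of pairs `(p, (g))` of a point `p` of `X` and a conjugacy class of `G_p`. -/
def Inertia : Type u := Σ p : X, ConjClasses (O.localGroup p)

/-- For a uniformizing system `c` and `x ∈ V^g`, the point of `X̃` that `(x, g)` represents: it lies
over `p = π x`, and its conjugacy class is that of the element of `G_p` which corresponds to `g`
under a change of charts that takes `x` to the chosen point over `p`. -/
def Represents (c : O.atlas) (g : c.1.G) (x : Cn n) (z : O.Inertia) : Prop :=
  x ∈ c.1.fix g ∧
  ∃ φ, IsTransition c.1 (O.chartAt z.1).1 φ ∧ x ∈ φ.source ∧ φ x = O.liftAt z.1 ∧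
    ∃ h : O.localGroup z.1, ConjClasses.mk h = z.2 ∧
      ∀ᶠ y in 𝓝 x, φ (c.1.act g y) = (O.chartAt z.1).1.act h (φ y)

/-- The natural topology of `X̃`: a set is open if its preimage in each fixed point set `V^g` is
relatively open. -/
instance : TopologicalSpace O.Inertia where
  IsOpen U := ∀ (c : O.atlas) (g : c.1.G), ∃ W : Set (Cn n), IsOpen W ∧
    ∀ x z, O.Represents c g x z → (z ∈ U ↔ x ∈ W)
  isOpen_univ := fun _ _ => ⟨univ, isOpen_univ, by simp⟩
  isOpen_inter := by
    intro U U' h h' c g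
    obtain ⟨W, hW, e⟩ := h c g
    obtain ⟨W', hW', e'⟩ := h' c g
    exact ⟨W ∩ W', hW.inter hW', fun x z hz => and_congr (e x z hz) (e' x z hz)⟩
  isOpen_sUnion := by
    intro S h c g
    choose W hW e using fun U : S => h U.1 U.2 c g
    refine ⟨⋃ U, W U, isOpen_iUnion hW, fun x z hz => ?_⟩
    rw [mem_sUnion, mem_iUnion]
    constructor
    · rintro ⟨U, hU, hzU⟩
      exact ⟨⟨U, hU⟩, (e ⟨U, hU⟩ x z hz).1 hzU⟩
    · rintro ⟨U, hU⟩
      exact ⟨U.1, U.2, (e U x z hz).2 hU⟩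

/-- The point `(p, (1))` of `X̃`. -/
def trivialPt (p : X) : O.Inertia := ⟨p, 1⟩

/-- The involution `I (p, (g)) = (p, (g⁻¹))` of `X̃`. -/
def invol (z : O.Inertia) : O.Inertia :=
  ⟨z.1, Quotient.map (fun g => g⁻¹) (fun a b (h : IsConj a b) => by
    obtain ⟨c, rfl⟩ := isConj_iff.1 h
    exact isConj_iff.2 ⟨c, by group⟩) z.2⟩

/-- Elementary equivalence: two points of `X̃` that are represented by the same group element `g` of
a uniformizing system, at two points of a connected part of `V^g`. -/
def Adjacent (z w : O.Inertia) : Prop :=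
  ∃ (c : O.atlas) (g : c.1.G) (S : Set (Cn n)), S ⊆ c.1.fix g ∧ IsPreconnected S ∧
    ∃ x ∈ S, ∃ y ∈ S, O.Represents c g x z ∧ O.Represents c g y w

/-- The equivalence relation among the `(g)_{G_p}`, generated by elementary equivalence. -/
def sectorSetoid : Setoid O.Inertia := Relation.EqvGen.setoid O.Adjacent

/-- The set `T` of equivalence classes `(g)`. -/
def T : Type u := Quotient O.sectorSetoid

/-- The equivalence class of a point of `X̃`. -/
def toT (z : O.Inertia) : O.T := Quotient.mk O.sectorSetoid z

/-- The sector `X_(g)`, with the topology of a subspace of `X̃`. -/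
def sector (t : O.T) : Set O.Inertia := {z | O.toT z = t}

end Orbifold

/-- An almost complex structure on an orbifold: smooth almost complex structures on the domains of
the uniformizing systems that are invariant under the group actions and the changes of charts. -/
structure AlmostComplex (O : Orbifold n X) where
  J : O.atlas → Cn n → (Cn n →L[ℝ] Cn n)
  smooth : ∀ c, ContDiffOn ℝ ∞ (J c) c.1.dom
  sq : ∀ c, ∀ x ∈ c.1.dom, ∀ v, J c x (J c x v) = -v
  act_comm : ∀ c, ∀ g, ∀ x ∈ c.1.dom, ∀ v,
    fderiv ℝ (c.1.act g) x (J c x v) = J c (c.1.act g x) (fderiv ℝ (c.1.act g) x v)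
  transition_comm : ∀ c c' : O.atlas, ∀ φ, IsTransition c.1 c'.1 φ → ∀ x ∈ φ.source, ∀ v,
    fderiv ℝ φ x (J c x v) = J c' (φ x) (fderiv ℝ φ x v)

/-- The complex vector space given by the real vector space `ℂⁿ` and an operator `J` with
`J² = -1`: the scalar `a + b i` acts as `a + b J`. -/
def JSpace (J : Cn n →L[ℝ] Cn n) (_ : ∀ v, J (J v) = -v) : Type := Cn n

namespace JSpace

variable {J : Cn n →L[ℝ] Cn n} {hJ : ∀ v, J (J v) = -v}

instance : AddCommGroup (JSpace J hJ) := inferInstanceAs (AddCommGroup (Cn n))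

/-- Multiplication by `a + b i`, as `a + b J`. -/
def csmul (J : Cn n →L[ℝ] Cn n) (z : ℂ) (v : Cn n) : Cn n := z.re • v + z.im • J v

instance : Module ℂ (JSpace J hJ) where
  smul := csmul J
  one_smul := by
    have h : ∀ v : Cn n, csmul J 1 v = v := fun v => by simp [csmul]
    exact h
  mul_smul := by
    have h : ∀ (a b : ℂ) (v : Cn n), csmul J (a * b) v = csmul J a (csmul J b v) := fun a b v => by
      simp only [csmul, Complex.mul_re, Complex.mul_im, map_add, map_smul, hJ]
      module
    exact h
  smul_zero := by
    have h : ∀ a : ℂ, csmul J a 0 = 0 := fun a => by simp [csmul]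
    exact h
  smul_add := by
    have h : ∀ (a : ℂ) (v w : Cn n), csmul J a (v + w) = csmul J a v + csmul J a w :=
      fun a v w => by
        simp only [csmul, map_add]
        module
    exact h
  add_smul := by
    have h : ∀ (a b : ℂ) (v : Cn n), csmul J (a + b) v = csmul J a v + csmul J b v :=
      fun a b v => by
        simp only [csmul, Complex.add_re, Complex.add_im]
        module
    exact h
  zero_smul := by
    have h : ∀ v : Cn n, csmul J 0 v = 0 := fun v => by simp [csmul]
    exact h

/-- A real linear operator that commutes with `J`, as a complex linear operator. -/
def endo (A : Cn n →L[ℝ] Cn n) (hA : ∀ v, A (J v) = J (A v)) : Module.End ℂ (JSpace J hJ) where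
  toFun := A
  map_add' := A.map_add
  map_smul' := by
    have h : ∀ (z : ℂ) (v : Cn n), A (csmul J z v) = csmul J z (A v) := fun z v => by
      simp only [csmul, map_add, map_smul, hA]
    exact h

end JSpace

/-- For an operator `A` with `A ^ m = 1`, the sum of `k / m` over the eigenvalues `e^{2πik/m}` of `A`,
`0 ≤ k < m`, counted with multiplicity. -/
def ageSum {V : Type*} [AddCommGroup V] [Module ℂ V] (A : Module.End ℂ V) (m : ℕ) : ℚ :=
  ∑ k ∈ Finset.range m, (k / m : ℚ) *
    Module.finrank ℂ (Module.End.eigenspace A (Complex.exp (2 * Real.pi * Complex.I * (k / m))))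

/-- Sanity check: if `A = diag(e^{2πi e₁/m}, …, e^{2πi e_n/m})` in some basis, where `0 ≤ eᵢ < m`,
then `ageSum A m = ∑ eᵢ / m`. -/
theorem ageSum_of_diagonal {V : Type*} [AddCommGroup V] [Module ℂ V] {ι : Type*} [Fintype ι]
    (A : Module.End ℂ V) (m : ℕ) (b : Module.Basis ι ℂ V) (e : ι → ℕ) (he : ∀ i, e i < m)
    (hb : ∀ i, A (b i) = Complex.exp (2 * Real.pi * Complex.I * (e i / m)) • b i) :
    ageSum A m = ∑ i, (e i / m : ℚ) := by
  classical
  have hinj : ∀ k < m, ∀ l < m, Complex.exp (2 * Real.pi * Complex.I * (k / m)) =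
      Complex.exp (2 * Real.pi * Complex.I * (l / m)) → k = l := by
    intro k hk l hl h
    have hm : m ≠ 0 := by omega
    have hp := Complex.isPrimitiveRoot_exp m hm
    refine hp.pow_inj hk hl ?_
    rw [← Complex.exp_nat_mul, ← Complex.exp_nat_mul]
    convert h using 2 <;> ring
  have key : ∀ k < m, Module.finrank ℂ (Module.End.eigenspace A
      (Complex.exp (2 * Real.pi * Complex.I * (k / m)))) =
      (Finset.univ.filter fun i => e i = k).card := by
    intro k hk
    have hsp : Module.End.eigenspace A (Complex.exp (2 * Real.pi * Complex.I * (k / m))) =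
        Submodule.span ℂ (Set.range fun i : {i // e i = k} => b i) := by
      apply le_antisymm
      · intro v hv
        rw [Module.End.mem_eigenspace_iff] at hv
        have hz : ∀ i, e i ≠ k → b.repr v i = 0 := by
          intro i hi
          have h1 : A v = ∑ j, (b.repr v j *
              Complex.exp (2 * Real.pi * Complex.I * (e j / m))) • b j := by
            conv_lhs => rw [← b.sum_repr v, map_sum]
            exact Finset.sum_congr rfl fun j _ => by rw [map_smul, hb, smul_smul]
          have h2 := congrArg (fun w => b.repr w i) (h1.symm.trans hv)
          simp only [b.repr_sum_self, map_smul, Finsupp.smul_apply, smul_eq_mul] at h2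
          have h3 : Complex.exp (2 * Real.pi * Complex.I * (e i / m)) -
              Complex.exp (2 * Real.pi * Complex.I * (k / m)) ≠ 0 := by
            intro h
            exact hi (hinj _ (he i) _ hk (sub_eq_zero.1 h))
          have h4 : b.repr v i * (Complex.exp (2 * Real.pi * Complex.I * (e i / m)) -
              Complex.exp (2 * Real.pi * Complex.I * (k / m))) = 0 := by
            rw [mul_sub, h2]; ring
          exact (mul_eq_zero.1 h4).resolve_right h3
        rw [← b.sum_repr v]
        refine Submodule.sum_mem _ fun i _ => ?_
        by_cases hi : e i = k
        · exact Submodule.smul_mem _ _ (Submodule.subset_span ⟨⟨i, hi⟩, rfl⟩)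
        · rw [hz i hi, zero_smul]; exact Submodule.zero_mem _
      · rw [Submodule.span_le]
        rintro _ ⟨⟨i, rfl⟩, rfl⟩
        exact Module.End.mem_eigenspace_iff.2 (hb i)
    rw [hsp, ← Fintype.card_subtype]
    exact finrank_span_eq_card (b.linearIndependent.comp _ Subtype.val_injective)
  unfold ageSum
  rw [← Finset.sum_fiberwise_of_maps_to (g := e) (t := Finset.range m)
    (fun i _ => Finset.mem_range.2 (he i))]
  refine Finset.sum_congr rfl fun k hk => ?_
  rw [key k (Finset.mem_range.1 hk), Finset.sum_congr rfl (g := fun _ => (k / m : ℚ))]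
  · rw [Finset.sum_const, nsmul_eq_mul, mul_comm]
  · intro i hi
    rw [(Finset.mem_filter.1 hi).2]

namespace AlmostComplex

variable {O : Orbifold n X} (J : AlmostComplex O)

/-- The tangent space of the orbifold at `p`: that of the chosen uniformizing system at the chosen
point over `p`, as a complex vector space. -/
abbrev TangentAt (p : X) : Type :=
  JSpace (J.J (O.chartAt p) (O.liftAt p)) (J.sq (O.chartAt p) (O.liftAt p) (O.liftAt_mem p))

/-- The complex linear action of the local group `G_p` on the tangent space at `p`, by derivatives.
In complex coordinates this is the inclusion of `G_p` into `GL(n, ℂ)`. -/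
def isotropy (p : X) : O.localGroup p →* Module.End ℂ (J.TangentAt p) where
  toFun g := JSpace.endo (fderiv ℝ ((O.chartAt p).1.act g) (O.liftAt p)) (fun v => by
    have h := J.act_comm (O.chartAt p) g (O.liftAt p) (O.liftAt_mem p) v
    rwa [show (O.chartAt p).1.act g (O.liftAt p) = O.liftAt p from g.2] at h)
  map_one' := by
    have h : (O.chartAt p).1.act 1 =ᶠ[𝓝 (O.liftAt p)] id := by
      filter_upwards [(O.chartAt p).1.isOpen_dom.mem_nhds (O.liftAt_mem p)] with y hy
      exact (O.chartAt p).1.act_one y hy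
    have h' := h.fderiv_eq (𝕜 := ℝ)
    rw [fderiv_id] at h'
    ext v
    exact congrArg (fun A : Cn n →L[ℝ] Cn n => A v) h'
  map_mul' a b := by
    have hd : ∀ g : (O.chartAt p).1.G,
        DifferentiableAt ℝ ((O.chartAt p).1.act g) (O.liftAt p) := fun g =>
      (((O.chartAt p).1.act_smooth g).contDiffAt
        ((O.chartAt p).1.isOpen_dom.mem_nhds (O.liftAt_mem p))).differentiableAt (by simp)
    have hb : (O.chartAt p).1.act b (O.liftAt p) = O.liftAt p := b.2
    have h : (O.chartAt p).1.act (a * b : O.localGroup p) =ᶠ[𝓝 (O.liftAt p)]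
        (O.chartAt p).1.act a ∘ (O.chartAt p).1.act b := by
      filter_upwards [(O.chartAt p).1.isOpen_dom.mem_nhds (O.liftAt_mem p)] with y hy
      exact (O.chartAt p).1.act_mul a b y hy
    have h' := h.fderiv_eq (𝕜 := ℝ)
    rw [fderiv_comp _ (by rw [hb]; exact hd a) (hd b), hb] at h'
    ext v
    exact congrArg (fun A : Cn n →L[ℝ] Cn n => A v) h'

/-- The degree shifting function `ι : X̃ → ℚ`. If `g` of order `m_g` is diagonal with entries
`e^{2πi mᵢ/m_g}`, `0 ≤ mᵢ < m_g`, then `ι (p, (g)) = ∑ mᵢ / m_g`. -/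
def shift (z : O.Inertia) : ℚ :=
  Quotient.lift (fun g : O.localGroup z.1 => ageSum (J.isotropy z.1 g) (orderOf g))
    (fun a b (h : IsConj a b) => by
      obtain ⟨c, rfl⟩ := isConj_iff.1 h
      have ho : orderOf (c * a * c⁻¹) = orderOf a := (MulAut.conj c).orderOf_eq a
      simp only [ho]
      refine Finset.sum_congr rfl fun k _ => ?_
      congr 2
      set μ := Complex.exp (2 * Real.pi * Complex.I * (k / orderOf a))
      have hc : ∀ (x y : O.localGroup z.1) (v : J.TangentAt z.1),
          J.isotropy z.1 (x * y) v = J.isotropy z.1 x (J.isotropy z.1 y v) := fun x y v => by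
        rw [map_mul]; rfl
      have h1 : ∀ v, J.isotropy z.1 1 v = v := fun v => by rw [map_one]; rfl
      refine LinearEquiv.finrank_eq (LinearEquiv.ofLinearMap
        ((J.isotropy z.1 c).restrict (q := Module.End.eigenspace _ μ) fun v hv => ?_)
        ((J.isotropy z.1 c⁻¹).restrict (q := Module.End.eigenspace _ μ) fun v hv => ?_) ?_ ?_)
      · rw [Module.End.mem_eigenspace_iff] at hv ⊢
        rw [← hc, inv_mul_cancel_right, hc, hv, map_smul]
      · rw [Module.End.mem_eigenspace_iff] at hv ⊢
        rw [← map_smul, ← hv, ← hc, ← hc]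
        congr 2
        group
      · ext v
        change J.isotropy z.1 c (J.isotropy z.1 c⁻¹ v) = v
        rw [← hc, mul_inv_cancel, h1]
      · ext v
        change J.isotropy z.1 c⁻¹ (J.isotropy z.1 c v) = v
        rw [← hc, inv_mul_cancel, h1]) z.2

/-- The almost complex orbifold structure `(O', J')` on a sector is the natural one: each of its
uniformizing systems is, locally, identified by a pseudo-holomorphic diffeomorphism `f` (with smooth
inverse `r`) with an open piece `N ∩ V^g` of a fixed point set of a uniformizing system of `X`, in such
a way that the projection to `X_(g) ⊆ X̃` becomes `y ↦ (π y, (g))`. -/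
def IsNatural {t : O.T} {d : ℕ} {O' : Orbifold d (O.sector t)} (J' : AlmostComplex O') : Prop :=
  ∀ c' : O'.atlas, ∀ w₀ ∈ c'.1.dom, ∃ (c : O.atlas) (g : c.1.G) (W : Set (Cn d)) (N : Set (Cn n))
    (f : Cn d → Cn n) (r : Cn n → Cn d),
    IsOpen W ∧ w₀ ∈ W ∧ W ⊆ c'.1.dom ∧ IsOpen N ∧ ContDiffOn ℝ ∞ f W ∧ ContDiffOn ℝ ∞ r N ∧
    MapsTo f W (N ∩ c.1.fix g) ∧ MapsTo r (N ∩ c.1.fix g) W ∧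
    (∀ w ∈ W, r (f w) = w) ∧ (∀ y ∈ N ∩ c.1.fix g, f (r y) = y) ∧
    (∀ w ∈ W, ∀ v, fderiv ℝ f w (J'.J c' w v) = J.J c (f w) (fderiv ℝ f w v)) ∧
    (∀ w ∈ W, O.Represents c g (f w) (c'.1.proj w).1)

end AlmostComplex

end CROrbifold

end

/-! Everything is local on the fixed point sets `V^g`, and three facts about uniformizing systems
carry the argument. Averaging over the isotropy group of `x` makes its action linear near `x`
(`Chart.exists_linearization`), so that `V^g` becomes a convex piece of the fixed space of `dg`.
Since `V` is connected and the action effective, a group element is determined by its value and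
derivative at one point (`Chart.eq_of_fderiv_eq`). With Baire's theorem it follows that a change of
charts from a system to itself is locally the action of a group element
(`IsTransition.exists_eventuallyEq_act`); hence the class in `G_p` that corresponds to `g` does not
depend on choices, and two representatives of a point of `X̃` differ by a change of charts.

As `V^g` is locally connected, the sectors are open, hence also closed. As connected parts of `V^g`
have connected images in `X̃`, a sector lies in one component. So the sectors are the components of
`X̃` (`Orbifold.sector_toT`). The classes of `(1)` are then found from the continuity of `p ↦ (p,
(1))` and of the projection to `X`.

The eigenvalues of `dg` are roots of unity. Their multiplicities are upper semicontinuous along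
`V^g` and have a constant sum, so they are locally constant
(`AlmostComplex.isLocallyConstant_multAt`); this makes `ι` and the dimension of `V^g` constant on
sectors. The numerical claims concern one diagonal matrix: its determinant is `exp (2πi ι)`;
inversion replaces each nonzero exponent `k` by `m - k`, so that `ι(g) + ι(g⁻¹)` counts the
eigenvalues other than `1`; and `ι = 0` forces `dg = 1`, hence `g = 1` by the rigidity above.

The charts of a sector are slices of `V^g` in linear coordinates, acted on by the centralizer of `g`
in the isotropy group, modulo the elements that act trivially. Since `J` commutes with `dg`, it
preserves the tangent spaces of `V^g` and restricts to the slices. -/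

noncomputable section

namespace CROrbifold

variable {n : ℕ} {X : Type u} [TopologicalSpace X]

/-! ### Linearization of the isotropy action. -/

namespace Chart

variable (c : Chart n X)

lemma act_inv_act (g : c.G) {x : Cn n} (hx : x ∈ c.dom) : c.act g⁻¹ (c.act g x) = x := by
  rw [← c.act_mul _ _ x hx, inv_mul_cancel, c.act_one x hx]

lemma act_act_inv (g : c.G) {x : Cn n} (hx : x ∈ c.dom) : c.act g (c.act g⁻¹ x) = x := by
  rw [← c.act_mul _ _ x hx, mul_inv_cancel, c.act_one x hx]

lemma act_inv_eq {g : c.G} {x y : Cn n} (hx : x ∈ c.dom) (h : c.act g x = y) :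
    c.act g⁻¹ y = x := by
  rw [← h, c.act_inv_act g hx]

lemma proj_act (g : c.G) {x : Cn n} (hx : x ∈ c.dom) : c.proj (c.act g x) = c.proj x :=
  ((c.proj_eq_iff x hx _ (c.act_mem g x hx)).2 ⟨g, rfl⟩).symm

lemma contDiffAt_act (g : c.G) {x : Cn n} (hx : x ∈ c.dom) : ContDiffAt ℝ ∞ (c.act g) x :=
  (c.act_smooth g).contDiffAt (c.isOpen_dom.mem_nhds hx)

lemma differentiableAt_act (g : c.G) {x : Cn n} (hx : x ∈ c.dom) :
    DifferentiableAt ℝ (c.act g) x :=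
  (c.contDiffAt_act g hx).differentiableAt (by simp)

lemma continuousAt_act (g : c.G) {x : Cn n} (hx : x ∈ c.dom) : ContinuousAt (c.act g) x :=
  (c.contDiffAt_act g hx).continuousAt

lemma fderiv_act_one {x : Cn n} (hx : x ∈ c.dom) :
    fderiv ℝ (c.act 1) x = ContinuousLinearMap.id ℝ (Cn n) := by
  have h : c.act 1 =ᶠ[𝓝 x] id := by
    filter_upwards [c.isOpen_dom.mem_nhds hx] with y hy using c.act_one y hy
  rw [h.fderiv_eq (𝕜 := ℝ), fderiv_id]

lemma act_mul_eventually (g h : c.G) {x : Cn n} (hx : x ∈ c.dom) :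
    c.act (g * h) =ᶠ[𝓝 x] c.act g ∘ c.act h := by
  filter_upwards [c.isOpen_dom.mem_nhds hx] with y hy using c.act_mul g h y hy

lemma fderiv_act_mul (g h : c.G) {x : Cn n} (hx : x ∈ c.dom) :
    fderiv ℝ (c.act (g * h)) x =
      (fderiv ℝ (c.act g) (c.act h x)).comp (fderiv ℝ (c.act h) x) := by
  rw [(c.act_mul_eventually g h hx).fderiv_eq (𝕜 := ℝ),
    fderiv_comp _ (c.differentiableAt_act g (c.act_mem h x hx)) (c.differentiableAt_act h hx)]

lemma fderiv_act_inv_apply (g : c.G) {x : Cn n} (hx : x ∈ c.dom) (v : Cn n) :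
    fderiv ℝ (c.act g⁻¹) (c.act g x) (fderiv ℝ (c.act g) x v) = v := by
  have h := c.fderiv_act_mul g⁻¹ g hx
  rw [inv_mul_cancel, c.fderiv_act_one hx] at h
  exact (congrArg (fun A : Cn n →L[ℝ] Cn n => A v) h).symm

lemma continuousOn_fderiv_act (g : c.G) : ContinuousOn (fderiv ℝ (c.act g)) c.dom :=
  (c.act_smooth g).continuousOn_fderiv_of_isOpen c.isOpen_dom (by simp)

/-- The action of a group element, as a partial homeomorphism of `ℂⁿ`. -/
def actHomeo (g : c.G) : OpenPartialHomeomorph (Cn n) (Cn n) where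
  toFun := c.act g
  invFun := c.act g⁻¹
  source := c.dom
  target := c.dom
  map_source' := c.act_mem g
  map_target' := c.act_mem g⁻¹
  left_inv' _ hx := c.act_inv_act g hx
  right_inv' _ hx := c.act_act_inv g hx
  open_source := c.isOpen_dom
  open_target := c.isOpen_dom
  continuousOn_toFun := (c.act_smooth g).continuousOn
  continuousOn_invFun := (c.act_smooth g⁻¹).continuousOn

lemma isTransition_actHomeo (g : c.G) : IsTransition c c (c.actHomeo g) where
  source_subset := Subset.rfl
  target_subset := Subset.rfl
  smooth := c.act_smooth g
  smooth_symm := c.act_smooth g⁻¹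
  proj_eq _ hx := c.proj_act g hx

/-- For each of the finitely many `h` that move `x`, separate `x` from `h x` and shrink until no
point of the neighbourhood is carried back into it. -/
lemma exists_nhds_act_mem_imp_stab {x : Cn n} (hx : x ∈ c.dom) :
    ∃ U, IsOpen U ∧ x ∈ U ∧ U ⊆ c.dom ∧ ∀ h : c.G, ∀ y ∈ U, c.act h y ∈ U → c.act h x = x := by
  have key : ∀ h : c.G, ∃ U, IsOpen U ∧ x ∈ U ∧ ∀ y ∈ U, c.act h y ∈ U → c.act h x = x := by
    intro h
    by_cases hh : c.act h x = x
    · exact ⟨univ, isOpen_univ, mem_univ _, fun _ _ _ => hh⟩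
    · obtain ⟨A, B, hA, hB, hxA, hxB, hAB⟩ := t2_separation hh
      obtain ⟨U, hU, hUo, hxU⟩ := mem_nhds_iff.1
        (inter_mem ((c.continuousAt_act h hx).preimage_mem_nhds (hA.mem_nhds hxA))
          (hB.mem_nhds hxB))
      exact ⟨U, hUo, hxU, fun y hy hy' =>
        absurd rfl (hAB.ne_of_mem (hU hy).1 (hU hy').2)⟩
  choose U hU hxU hUs using key
  refine ⟨c.dom ∩ ⋂ h, U h, c.isOpen_dom.inter (isOpen_iInter_of_finite hU),
    ⟨hx, mem_iInter.2 hxU⟩, inter_subset_left, fun h y hy hy' => ?_⟩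
  exact hUs h y (mem_iInter.1 hy.2 h) (mem_iInter.1 hy'.2 h)

/-- The average over the isotropy group of `x` of the maps `y ↦ (dh x)⁻¹ (h y - x)`. -/
def average {x : Cn n} (hx : x ∈ c.dom) (y : Cn n) : Cn n :=
  letI := Fintype.ofFinite (c.stab hx)
  (Nat.card (c.stab hx) : ℝ)⁻¹ •
    ∑ h : c.stab hx, fderiv ℝ (c.act (h⁻¹ : c.stab hx)) x (c.act h y - x)

/-- Replacing `h` by `h k` permutes the sum, and `(dh)⁻¹ = dk ∘ (d(hk))⁻¹` lets `dk` come out of it.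
-/
lemma average_act {x : Cn n} (hx : x ∈ c.dom) (k : c.stab hx) {y : Cn n} (hy : y ∈ c.dom) :
    c.average hx (c.act k y) = fderiv ℝ (c.act k) x (c.average hx y) := by
  unfold average
  let _ := Fintype.ofFinite (c.stab hx)
  rw [map_smul, map_sum]
  congr 1
  refine Fintype.sum_equiv (Equiv.mulRight k) _ _ fun h => ?_
  have h1 : c.act (h⁻¹ : c.stab hx) x = x := (h⁻¹).2
  have h2 : fderiv ℝ (c.act (h⁻¹ : c.stab hx)) x =
      (fderiv ℝ (c.act k) x).comp (fderiv ℝ (c.act ((h * k)⁻¹ : c.stab hx)) x) := by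
    have h3 := c.fderiv_act_mul k ((h * k)⁻¹ : c.stab hx) hx
    rw [show c.act ((h * k)⁻¹ : c.stab hx) x = x from ((h * k)⁻¹).2] at h3
    rw [← h3]
    congr 2
    simp
  rw [h2, Equiv.coe_mulRight]
  simp only [ContinuousLinearMap.comp_apply, Subgroup.coe_mul]
  rw [c.act_mul _ _ y hy]

lemma average_self {x : Cn n} (hx : x ∈ c.dom) : c.average hx x = 0 := by
  unfold average
  let _ := Fintype.ofFinite (c.stab hx)
  rw [Finset.sum_eq_zero, smul_zero]
  intro h _
  rw [show c.act h x = x from h.2, sub_self, map_zero]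

lemma contDiffOn_average {x : Cn n} (hx : x ∈ c.dom) : ContDiffOn ℝ ∞ (c.average hx) c.dom := by
  unfold average
  refine ContDiffOn.const_smul _ (ContDiffOn.sum fun h _ => ?_)
  exact (fderiv ℝ (c.act (h⁻¹ : c.stab hx)) x).contDiff.comp_contDiffOn
    ((c.act_smooth h).sub contDiffOn_const)

/-- Every summand has derivative `(dh)⁻¹ ∘ dh = 1` at `x`; thus the average is a local coordinate
there. -/
lemma hasFDerivAt_average {x : Cn n} (hx : x ∈ c.dom) :
    HasFDerivAt (c.average hx) (ContinuousLinearMap.id ℝ (Cn n)) x := by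
  unfold average
  let _ := Fintype.ofFinite (c.stab hx)
  have h1 : ∀ h : c.stab hx, HasFDerivAt
      (fun y => fderiv ℝ (c.act (h⁻¹ : c.stab hx)) x (c.act h y - x))
      (ContinuousLinearMap.id ℝ (Cn n)) x := by
    intro h
    have h2 := (fderiv ℝ (c.act (h⁻¹ : c.stab hx)) x).hasFDerivAt.comp x
      ((c.differentiableAt_act h hx).hasFDerivAt.sub_const x)
    refine h2.congr_fderiv ?_
    ext1 v
    symm
    have h3 := c.fderiv_act_inv_apply (h : c.G) hx v
    rw [show c.act h x = x from h.2] at h3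
    exact h3.symm
  have h2 := (HasFDerivAt.fun_sum (u := Finset.univ) fun h _ => h1 h).const_smul
    ((Nat.card (c.stab hx) : ℝ)⁻¹)
  refine h2.congr_fderiv ?_
  rw [Finset.sum_const, Finset.card_univ, ← Nat.card_eq_fintype_card, ← Nat.cast_smul_eq_nsmul ℝ,
    smul_smul, inv_mul_cancel₀, one_smul]
  exact_mod_cast Nat.card_pos.ne'

/-- Bochner's linearization: near `x`, the action of the isotropy group of `x` is linear in suitable
coordinates. -/
theorem exists_linearization {x : Cn n} (hx : x ∈ c.dom) :
    ∃ L : OpenPartialHomeomorph (Cn n) (Cn n), x ∈ L.source ∧ L.source ⊆ c.dom ∧ L x = 0 ∧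
      ContDiffOn ℝ ∞ L L.source ∧ ContDiffOn ℝ ∞ L.symm L.target ∧ Convex ℝ L.target ∧
      (∀ h, c.act h x = x → ∀ y ∈ L.source,
        c.act h y ∈ L.source ∧ L (c.act h y) = fderiv ℝ (c.act h) x (L y)) ∧
      (∀ h, ∀ y ∈ L.source, c.act h y ∈ L.source → c.act h x = x) := by
  obtain ⟨U, hUo, hxU, hUd, hUs⟩ := c.exists_nhds_act_mem_imp_stab hx
  set a := c.average hx with ha
  have hsm := c.contDiffOn_average hx
  have hst : HasStrictFDerivAt a (ContinuousLinearEquiv.refl ℝ (Cn n) : Cn n →L[ℝ] Cn n) x := by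
    have h1 := (hsm.contDiffAt (c.isOpen_dom.mem_nhds hx)).hasStrictFDerivAt (by simp)
    rwa [(c.hasFDerivAt_average hx).fderiv] at h1
  set e := hst.toOpenPartialHomeomorph a
  have hxe : x ∈ e.source := hst.mem_toOpenPartialHomeomorph_source
  -- the points where the derivative is invertible
  set I : Set (Cn n →L[ℝ] Cn n) := range ((↑) : (Cn n ≃L[ℝ] Cn n) → Cn n →L[ℝ] Cn n) with hI
  have hIo : IsOpen I := ContinuousLinearEquiv.isOpen
  have hfd : ContinuousOn (fderiv ℝ a) c.dom :=
    hsm.continuousOn_fderiv_of_isOpen c.isOpen_dom (by simp)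
  -- Invertibility of the derivative is kept on the whole domain because it gives smoothness of the
  -- inverse at every point of the target; `U` controls which group elements can return a point to
  -- the domain.
  set S₀ : Set (Cn n) := (c.dom ∩ fderiv ℝ a ⁻¹' I) ∩ (e.source ∩ U) with hS₀
  have hS₀o : IsOpen S₀ :=
    (hfd.isOpen_inter_preimage c.isOpen_dom hIo).inter (e.open_source.inter hUo)
  have hxS₀ : x ∈ S₀ := by
    refine ⟨⟨hx, ?_⟩, hxe, hxU⟩
    rw [mem_preimage, (c.hasFDerivAt_average hx).fderiv]
    exact ⟨ContinuousLinearEquiv.refl ℝ _, rfl⟩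
  -- Intersecting the preimages of `S₀` under the isotropy group gives an invariant open set.
  set S₁ : Set (Cn n) := ⋂ h : c.stab hx, c.dom ∩ c.act h ⁻¹' S₀ with hS₁
  have hS₁o : IsOpen S₁ := isOpen_iInter_of_finite fun h =>
    (c.act_smooth h).continuousOn.isOpen_inter_preimage c.isOpen_dom hS₀o
  have hxS₁ : x ∈ S₁ := mem_iInter.2 fun h => ⟨hx, by
    rw [mem_preimage, show c.act h x = x from h.2]; exact hxS₀⟩
  have hS₁d : S₁ ⊆ c.dom := fun y hy => (mem_iInter.1 hy 1).1
  have hS₁S₀ : S₁ ⊆ S₀ := fun y hy => by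
    have h1 := (mem_iInter.1 hy 1).2
    rwa [mem_preimage, Subgroup.coe_one, c.act_one y (hS₁d hy)] at h1
  have hS₁inv : ∀ h : c.stab hx, ∀ y ∈ S₁, c.act h y ∈ S₁ := by
    intro h y hy
    refine mem_iInter.2 fun k => ⟨c.act_mem _ _ (hS₁d hy), ?_⟩
    have h1 := (mem_iInter.1 hy (k * h)).2
    rwa [mem_preimage, Subgroup.coe_mul, c.act_mul _ _ y (hS₁d hy)] at h1
  set e₁ := e.restr S₁ with he₁
  have he₁s : e₁.source = S₁ := by
    rw [he₁, e.restr_source' S₁ hS₁o]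
    exact inter_eq_right.2 fun y hy => (hS₁S₀ hy).2.1
  have hxe₁ : x ∈ e₁.source := by rw [he₁s]; exact hxS₁
  have h0 : (0 : Cn n) ∈ e₁.target := by
    have := e₁.map_source hxe₁
    rwa [show e₁ x = 0 from c.average_self hx] at this
  obtain ⟨ε, hε, hball⟩ := Metric.isOpen_iff.1 e₁.open_target 0 h0
  -- The same device for the linear action: preimages of a ball under linear maps are convex, so `M`
  -- is invariant and convex at once.
  set M : Set (Cn n) := ⋂ h : c.stab hx, fderiv ℝ (c.act h) x ⁻¹' Metric.ball 0 ε with hM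
  have hMo : IsOpen M := isOpen_iInter_of_finite fun h =>
    Metric.isOpen_ball.preimage (fderiv ℝ (c.act h) x).continuous
  have hMc : Convex ℝ M := convex_iInter fun h =>
    (convex_ball (0 : Cn n) ε).linear_preimage (fderiv ℝ (c.act h) x).toLinearMap
  have hMt : M ⊆ e₁.target := fun v hv => hball (by
    have h1 := mem_iInter.1 hv 1
    rwa [mem_preimage, Subgroup.coe_one, c.fderiv_act_one hx] at h1)
  have hMinv : ∀ h : c.stab hx, ∀ v ∈ M, fderiv ℝ (c.act h) x v ∈ M := by
    intro h v hv
    refine mem_iInter.2 fun k => ?_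
    have h1 := mem_iInter.1 hv (k * h)
    rwa [mem_preimage, Subgroup.coe_mul, c.fderiv_act_mul _ _ hx,
      show c.act h x = x from h.2] at h1
  -- Restricting the inverse makes the target equal to `M`; the source becomes the part of `S₁` that
  -- `a` sends into `M`, and inherits invariance from both.
  set L := (e₁.symm.restr M).symm with hL
  have hLs : ∀ y, y ∈ L.source ↔ y ∈ S₁ ∧ a y ∈ M := by
    intro y
    have h1 : L.source = e₁.source ∩ e₁ ⁻¹' M := by
      rw [hL, he₁]
      simp [hMo.interior_eq]
    rw [h1, he₁s]; rfl
  have hLt : L.target = M := by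
    have h1 : L.target = e₁.target ∩ M := by
      rw [hL]
      simp [hMo.interior_eq]
    rw [h1]; exact inter_eq_right.2 hMt
  have hact : ∀ h : c.stab hx, ∀ y ∈ c.dom, a (c.act h y) = fderiv ℝ (c.act h) x (a y) :=
    fun h y hy => c.average_act hx h hy
  refine ⟨L, ?_, ?_, c.average_self hx, ?_, ?_, ?_, ?_, ?_⟩
  · rw [hLs, ha, c.average_self hx]
    exact ⟨hxS₁, mem_iInter.2 fun h => by simp [hε]⟩
  · exact fun y hy => hS₁d ((hLs y).1 hy).1
  · exact hsm.mono fun y hy => hS₁d ((hLs y).1 hy).1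
  · intro v hv
    have hy := L.map_target hv
    obtain ⟨A, hA⟩ := (hS₁S₀ ((hLs _).1 hy).1).1.2
    have hyd := hS₁d ((hLs _).1 hy).1
    have hcd : ContDiffAt ℝ ∞ L (L.symm v) := hsm.contDiffAt (c.isOpen_dom.mem_nhds hyd)
    refine (L.contDiffAt_symm (f₀' := A) hv ?_ hcd).contDiffWithinAt
    rw [hA]
    exact (hcd.differentiableAt (by simp)).hasFDerivAt
  · rw [hLt]; exact hMc
  · intro h hh y hy
    rw [hLs] at hy ⊢
    have h1 := hact ⟨h, hh⟩ y (hS₁d hy.1)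
    refine ⟨⟨hS₁inv ⟨h, hh⟩ y hy.1, ?_⟩, h1⟩
    rw [h1]
    exact hMinv ⟨h, hh⟩ _ hy.2
  · intro h y hy hy'
    rw [hLs] at hy hy'
    exact hUs h y (hS₁S₀ hy.1).2.2 (hS₁S₀ hy'.1).2.2

end Chart

/-! ### Rigidity: a group element is determined by its 1-jet at a point. -/

namespace Chart

variable (c : Chart n X)

/-- In linearizing coordinates `h` coincides with its derivative at `x`. -/
lemma act_eventuallyEq_id {h : c.G} {x : Cn n} (hx : x ∈ c.dom) (hh : c.act h x = x)
    (hd : fderiv ℝ (c.act h) x = ContinuousLinearMap.id ℝ (Cn n)) : c.act h =ᶠ[𝓝 x] id := by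
  obtain ⟨L, hxL, -, -, -, -, -, hL, -⟩ := c.exists_linearization hx
  filter_upwards [L.open_source.mem_nhds hxL] with y hy
  obtain ⟨h1, h2⟩ := hL h hh y hy
  rw [hd] at h2
  exact L.injOn h1 hy h2

/-- The set where `h` is locally the identity is open. It is also closed in the domain: at a limit
point the value and derivative of `h` are those of the identity by continuity, and the linearization
applies. Connectedness and effectiveness finish the proof. -/
lemma eq_one_of_eventuallyEq_id {h : c.G} {x : Cn n} (hx : x ∈ c.dom)
    (hh : c.act h =ᶠ[𝓝 x] id) : h = 1 := by
  set Z : Set (Cn n) := {y | c.act h =ᶠ[𝓝 y] id} with hZ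
  have hZo : IsOpen Z := isOpen_setOfPred_eventually_nhds
  have hZd : c.dom ⊆ Z := by
    refine c.isConnected_dom.isPreconnected.subset_of_closure_inter_subset hZo ⟨x, hx, hh⟩ ?_
    rintro y ⟨hy, hyd⟩
    have hne : (𝓝[Z] y).NeBot := mem_closure_iff_nhdsWithin_neBot.1 hy
    have h1 : c.act h y = y := by
      refine tendsto_nhds_unique_of_eventuallyEq
        ((c.continuousAt_act h hyd).mono_left nhdsWithin_le_nhds : Tendsto _ (𝓝[Z] y) _)
        (tendsto_id.mono_left nhdsWithin_le_nhds) ?_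
      filter_upwards [self_mem_nhdsWithin] with z hz using (hz : c.act h =ᶠ[𝓝 z] id).eq_of_nhds
    refine c.act_eventuallyEq_id hyd h1 ?_
    refine tendsto_nhds_unique_of_eventuallyEq
      (((c.continuousOn_fderiv_act h).continuousAt (c.isOpen_dom.mem_nhds hyd)).mono_left
        nhdsWithin_le_nhds : Tendsto _ (𝓝[Z] y) _) tendsto_const_nhds ?_
    filter_upwards [self_mem_nhdsWithin] with z hz
    rw [(hz : c.act h =ᶠ[𝓝 z] id).fderiv_eq (𝕜 := ℝ), fderiv_id]
  exact c.act_effective h fun y hy => (hZd hy : c.act h =ᶠ[𝓝 y] id).eq_of_nhds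

lemma eq_one_of_fderiv_eq_id {h : c.G} {x : Cn n} (hx : x ∈ c.dom) (hh : c.act h x = x)
    (hd : fderiv ℝ (c.act h) x = ContinuousLinearMap.id ℝ (Cn n)) : h = 1 :=
  c.eq_one_of_eventuallyEq_id hx (c.act_eventuallyEq_id hx hh hd)

lemma eq_of_fderiv_eq {g h : c.G} {x : Cn n} (hx : x ∈ c.dom) (hgh : c.act g x = c.act h x)
    (hd : fderiv ℝ (c.act g) x = fderiv ℝ (c.act h) x) : g = h := by
  have h1 : h⁻¹ * g = 1 := by
    refine c.eq_one_of_fderiv_eq_id hx ?_ ?_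
    · rw [c.act_mul _ _ x hx, hgh, c.act_inv_act h hx]
    · rw [c.fderiv_act_mul _ _ hx, hd, hgh]
      ext1 v
      exact c.fderiv_act_inv_apply h hx v
  exact (inv_mul_eq_one.1 h1).symm

lemma eq_of_eventuallyEq {g h : c.G} {x : Cn n} (hx : x ∈ c.dom)
    (hgh : c.act g =ᶠ[𝓝 x] c.act h) : g = h :=
  c.eq_of_fderiv_eq hx hgh.eq_of_nhds (hgh.fderiv_eq (𝕜 := ℝ))

end Chart

/-! ### Changes of charts and the group elements they determine. -/

namespace IsTransition

variable {c c' c'' : Chart n X} {φ ψ : OpenPartialHomeomorph (Cn n) (Cn n)}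

lemma symm (hφ : IsTransition c c' φ) : IsTransition c' c φ.symm where
  source_subset := hφ.target_subset
  target_subset := hφ.source_subset
  smooth := hφ.smooth_symm
  smooth_symm := hφ.smooth
  proj_eq x hx := by
    rw [← hφ.proj_eq _ (φ.map_target hx), φ.right_inv hx]

lemma trans (hφ : IsTransition c c' φ) (hψ : IsTransition c' c'' ψ) :
    IsTransition c c'' (φ.trans ψ) where
  source_subset x hx := hφ.source_subset (by simp at hx; exact hx.1)
  target_subset x hx := hψ.target_subset (by simp at hx; exact hx.1)
  smooth := by
    have h : (φ.trans ψ).source = φ.source ∩ φ ⁻¹' ψ.source := φ.trans_source ψ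
    rw [h, OpenPartialHomeomorph.coe_trans]
    exact hψ.smooth.comp (hφ.smooth.mono inter_subset_left) fun x hx => hx.2
  smooth_symm := by
    have h : (φ.trans ψ).target = ψ.target ∩ ψ.symm ⁻¹' φ.target := φ.trans_target ψ
    rw [h, OpenPartialHomeomorph.coe_trans_symm]
    exact hφ.smooth_symm.comp (hψ.smooth_symm.mono inter_subset_left) fun x hx => hx.2
  proj_eq x hx := by
    rw [φ.trans_source ψ] at hx
    rw [OpenPartialHomeomorph.coe_trans, Function.comp_apply, hψ.proj_eq _ hx.2,
      hφ.proj_eq _ hx.1]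

lemma contDiffAt (hφ : IsTransition c c' φ) {x : Cn n} (hx : x ∈ φ.source) :
    ContDiffAt ℝ ∞ φ x :=
  hφ.smooth.contDiffAt (φ.open_source.mem_nhds hx)

lemma differentiableAt (hφ : IsTransition c c' φ) {x : Cn n} (hx : x ∈ φ.source) :
    DifferentiableAt ℝ φ x :=
  (hφ.contDiffAt hx).differentiableAt (by simp)

lemma map_mem (hφ : IsTransition c c' φ) {x : Cn n} (hx : x ∈ φ.source) : φ x ∈ c'.dom :=
  hφ.target_subset (φ.map_source hx)

lemma mem_dom (hφ : IsTransition c c' φ) {x : Cn n} (hx : x ∈ φ.source) : x ∈ c.dom :=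
  hφ.source_subset hx

lemma fderiv_symm_apply (hφ : IsTransition c c' φ) {x : Cn n} (hx : x ∈ φ.source) (v : Cn n) :
    fderiv ℝ φ.symm (φ x) (fderiv ℝ φ x v) = v := by
  have h1 := (hφ.symm.differentiableAt (φ.map_source hx)).hasFDerivAt.comp x
    (hφ.differentiableAt hx).hasFDerivAt
  have h2 : φ.symm ∘ φ =ᶠ[𝓝 x] id := by
    filter_upwards [φ.open_source.mem_nhds hx] with y hy using φ.left_inv hy
  exact congrArg (fun A : Cn n →L[ℝ] Cn n => A v)
    ((h2.hasFDerivAt_iff.1 h1).unique (hasFDerivAt_id x))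

/-- A change of charts of a uniformizing system with itself is locally the action of a group
element. -/
theorem exists_eventuallyEq_act (hφ : IsTransition c c φ) {x : Cn n} (hx : x ∈ φ.source) :
    ∃ k : c.G, φ =ᶠ[𝓝 x] c.act k := by
  set E : c.G → Set (Cn n) := fun k => {y | φ =ᶠ[𝓝 y] c.act k} with hE
  have hdense : ∀ O : Set (Cn n), IsOpen O → O.Nonempty → O ⊆ φ.source →
      ∃ k, (E k ∩ O).Nonempty := by
    intro O hO hOn hOs
    have hcov : O ⊆ ⋃ k, {y | y ∈ O ∧ φ y = c.act k y} := by
      intro y hy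
      have hyd := hφ.mem_dom (hOs hy)
      obtain ⟨k, hk⟩ := (c.proj_eq_iff y hyd (φ y) (hφ.map_mem (hOs hy))).1
        (hφ.proj_eq y (hOs hy)).symm
      exact mem_iUnion.2 ⟨k, hy, hk.symm⟩
    -- At each point `φ` agrees with some `k`, so finitely many agreement sets cover `O`. By Baire
    -- one of them is dense in some open set, and by continuity `φ` equals `k` throughout that set.
    have h1 : ¬ IsMeagre (⋃ k, {y | y ∈ O ∧ φ y = c.act k y}) := fun h =>
      not_isMeagre_of_isOpen hO hOn (h.mono hcov)
    have h2 : ∃ k, ¬ IsNowhereDense {y | y ∈ O ∧ φ y = c.act k y} := by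
      by_contra! h
      exact h1 (isMeagre_iUnion fun k => (h k).isMeagre)
    obtain ⟨k, hk⟩ := h2
    obtain ⟨z, hz⟩ := nonempty_iff_ne_empty.2 hk
    obtain ⟨y, hy, hyO, -⟩ := mem_closure_iff.1 (interior_subset hz) _ isOpen_interior hz
    refine ⟨k, y, ?_, hyO⟩
    filter_upwards [isOpen_interior.mem_nhds hy, hO.mem_nhds hyO] with w hw hwO
    have hne : (𝓝[{y | y ∈ O ∧ φ y = c.act k y}] w).NeBot :=
      mem_closure_iff_nhdsWithin_neBot.1 (interior_subset hw)
    refine tendsto_nhds_unique_of_eventuallyEq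
      ((hφ.contDiffAt (hOs hwO)).continuousAt.mono_left nhdsWithin_le_nhds :
        Tendsto _ (𝓝[{y | y ∈ O ∧ φ y = c.act k y}] w) _)
      ((c.continuousAt_act k (hφ.mem_dom (hOs hwO))).mono_left nhdsWithin_le_nhds) ?_
    filter_upwards [self_mem_nhdsWithin] with v hv using hv.2
  have hcl : ∀ y ∈ φ.source, ∃ k, y ∈ closure (E k) := by
    intro y hy
    by_contra! h
    have hO : IsOpen (φ.source ∩ ⋂ k, (closure (E k))ᶜ) :=
      φ.open_source.inter (isOpen_iInter_of_finite fun k => isClosed_closure.isOpen_compl)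
    obtain ⟨k, z, hz, hz'⟩ := hdense _ hO ⟨y, hy, mem_iInter.2 h⟩ inter_subset_left
    exact mem_iInter.1 hz'.2 k (subset_closure hz)
  -- Equality of germs on `E k` passes to equality of 1-jets on its closure.
  have hval : ∀ y ∈ φ.source, ∀ k, y ∈ closure (E k) →
      φ y = c.act k y ∧ fderiv ℝ φ y = fderiv ℝ (c.act k) y := by
    intro y hy k hk
    have hyd := hφ.mem_dom hy
    have hne : (𝓝[E k] y).NeBot := mem_closure_iff_nhdsWithin_neBot.1 hk
    constructor
    · refine tendsto_nhds_unique_of_eventuallyEq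
        ((hφ.contDiffAt hy).continuousAt.mono_left nhdsWithin_le_nhds : Tendsto _ (𝓝[E k] y) _)
        ((c.continuousAt_act k hyd).mono_left nhdsWithin_le_nhds) ?_
      filter_upwards [self_mem_nhdsWithin] with z hz
        using (hz : φ =ᶠ[𝓝 z] c.act k).eq_of_nhds
    · refine tendsto_nhds_unique_of_eventuallyEq
        (((hφ.smooth.continuousOn_fderiv_of_isOpen φ.open_source (by simp)).continuousAt
          (φ.open_source.mem_nhds hy)).mono_left nhdsWithin_le_nhds : Tendsto _ (𝓝[E k] y) _)
        (((c.continuousOn_fderiv_act k).continuousAt (c.isOpen_dom.mem_nhds hyd)).mono_left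
          nhdsWithin_le_nhds) ?_
      filter_upwards [self_mem_nhdsWithin] with z hz
        using (hz : φ =ᶠ[𝓝 z] c.act k).fderiv_eq (𝕜 := ℝ)
  obtain ⟨k, hk⟩ := hcl x hx
  refine ⟨k, ?_⟩
  -- Two different elements would have the same 1-jet at `x`. So near `x` only the closure of `E k`
  -- is left to cover the source.
  have hsep : ∀ j, j ≠ k → x ∉ closure (E j) := by
    intro j hj hxj
    refine hj (c.eq_of_fderiv_eq (hφ.mem_dom hx) ?_ ?_)
    · rw [← (hval x hx j hxj).1, ← (hval x hx k hk).1]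
    · rw [← (hval x hx j hxj).2, ← (hval x hx k hk).2]
  have hev : ∀ᶠ y in 𝓝 x, ∀ j, j ≠ k → y ∉ closure (E j) :=
    eventually_all.2 fun j => by
      by_cases hj : j = k
      · exact Eventually.of_forall fun y h => absurd hj h
      · filter_upwards [isClosed_closure.isOpen_compl.mem_nhds (hsep j hj)] with y hy _ using hy
  filter_upwards [hev, φ.open_source.mem_nhds hx] with y hy hys
  obtain ⟨j, hj⟩ := hcl y hys
  by_cases hjk : j = k
  · rw [hjk] at hj
    exact (hval y hys k hj).1
  · exact absurd hj (hy j hjk)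

/-- Two changes of charts differ locally by the action of a group element. -/
theorem exists_eventuallyEq_act_comp (hφ : IsTransition c c' φ) (hψ : IsTransition c c' ψ)
    {x : Cn n} (hxφ : x ∈ φ.source) (hxψ : x ∈ ψ.source) :
    ∃ k : c'.G, ∀ᶠ y in 𝓝 x, φ y = c'.act k (ψ y) := by
  have hx : ψ x ∈ (ψ.symm.trans φ).source := by
    simp [hxψ, hxφ]
  obtain ⟨k, hk⟩ := (hψ.symm.trans hφ).exists_eventuallyEq_act hx
  refine ⟨k, ?_⟩
  have h1 : Tendsto ψ (𝓝 x) (𝓝 (ψ x)) := (hψ.contDiffAt hxψ).continuousAt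
  filter_upwards [h1.eventually hk, ψ.open_source.mem_nhds hxψ] with y hy hys
  rw [← hy, OpenPartialHomeomorph.coe_trans, Function.comp_apply, ψ.left_inv hys]

/-- A change of charts carries isotropy groups to isotropy groups. -/
theorem exists_conj (hφ : IsTransition c c' φ) {x : Cn n} (hx : x ∈ φ.source) {g : c.G}
    (hg : c.act g x = x) :
    ∃ h : c'.G, c'.act h (φ x) = φ x ∧ ∀ᶠ y in 𝓝 x, φ (c.act g y) = c'.act h (φ y) := by
  have hxs : x ∈ ((c.actHomeo g).trans φ).source := by
    rw [OpenPartialHomeomorph.trans_source]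
    refine ⟨hφ.mem_dom hx, ?_⟩
    change c.act g x ∈ φ.source
    rwa [hg]
  -- Both `φ ∘ g` and `φ` are changes of charts defined near `x`, so they differ by a group element.
  obtain ⟨h, hh⟩ := ((c.isTransition_actHomeo g).trans hφ).exists_eventuallyEq_act_comp hφ hxs hx
  refine ⟨h, ?_, hh⟩
  have h1 : φ (c.act g x) = c'.act h (φ x) := hh.self_of_nhds
  rw [← h1, hg]

end IsTransition

/-- Near `x`, the map `φ` carries the action of `g` to that of `h`. -/
def Intertwines (c c' : Chart n X) (φ : OpenPartialHomeomorph (Cn n) (Cn n)) (x : Cn n)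
    (g : c.G) (h : c'.G) : Prop :=
  ∀ᶠ y in 𝓝 x, φ (c.act g y) = c'.act h (φ y)

/-! ### The correspondence of isotropy elements under a change of charts. -/

namespace Intertwines

variable {c c' c'' : Chart n X} {φ ψ : OpenPartialHomeomorph (Cn n) (Cn n)} {x : Cn n}
  {g : c.G} {h : c'.G} {k : c''.G}

lemma act_apply (H : Intertwines c c' φ x g h) (hg : c.act g x = x) :
    c'.act h (φ x) = φ x := by
  rw [← H.self_of_nhds, hg]

lemma symm (H : Intertwines c c' φ x g h) (hφ : IsTransition c c' φ) (hx : x ∈ φ.source)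
    (hg : c.act g x = x) : Intertwines c' c φ.symm (φ x) h g := by
  have h1 : Tendsto φ.symm (𝓝 (φ x)) (𝓝 x) := by
    have := φ.continuousAt_symm (φ.map_source hx)
    rwa [ContinuousAt, φ.left_inv hx] at this
  have h2 : ∀ᶠ y in 𝓝 x, c.act g y ∈ φ.source :=
    (c.continuousAt_act g (hφ.mem_dom hx)).eventually
      (by rw [hg]; exact φ.open_source.mem_nhds hx)
  filter_upwards [h1.eventually H, h1.eventually h2,
    φ.open_target.mem_nhds (φ.map_source hx)] with y hy hy' hyt
  rw [φ.right_inv hyt] at hy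
  rw [← hy, φ.left_inv hy']

lemma trans (H : Intertwines c c' φ x g h) (H' : Intertwines c' c'' ψ (φ x) h k)
    (hx : x ∈ φ.source) : Intertwines c c'' (φ.trans ψ) x g k := by
  filter_upwards [H, (φ.continuousAt hx).eventually H'] with y hy hy'
  rw [OpenPartialHomeomorph.coe_trans, Function.comp_apply, Function.comp_apply, hy, hy']

/-- The images of points near `x` fill a neighbourhood of `φ x`, on which `h` and `h'` therefore
agree; germs determine group elements. -/
lemma unique {h' : c'.G} (H : Intertwines c c' φ x g h) (H' : Intertwines c c' φ x g h')
    (hφ : IsTransition c c' φ) (hx : x ∈ φ.source) : h = h' := by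
  refine c'.eq_of_eventuallyEq (hφ.map_mem hx) ?_
  have h1 : Tendsto φ.symm (𝓝 (φ x)) (𝓝 x) := by
    have := φ.continuousAt_symm (φ.map_source hx)
    rwa [ContinuousAt, φ.left_inv hx] at this
  filter_upwards [h1.eventually H, h1.eventually H',
    φ.open_target.mem_nhds (φ.map_source hx)] with y hy hy' hyt
  rw [φ.right_inv hyt] at hy hy'
  rw [← hy, hy']

lemma one (hφ : IsTransition c c' φ) (hx : x ∈ φ.source) :
    Intertwines c c' φ x 1 1 := by
  filter_upwards [φ.open_source.mem_nhds hx] with y hy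
  rw [c.act_one y (hφ.mem_dom hy), c'.act_one _ (hφ.map_mem hy)]

lemma mul {g' : c.G} {h' : c'.G} (H : Intertwines c c' φ x g h)
    (H' : Intertwines c c' φ x g' h') (hφ : IsTransition c c' φ) (hx : x ∈ φ.source)
    (hg' : c.act g' x = x) :
    Intertwines c c' φ x (g * g') (h * h') := by
  have h2 : Tendsto (c.act g') (𝓝 x) (𝓝 x) := by
    have := c.continuousAt_act g' (hφ.mem_dom hx)
    rwa [ContinuousAt, hg'] at this
  filter_upwards [h2.eventually H, H', φ.open_source.mem_nhds hx] with y hy hy' hys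
  rw [c.act_mul _ _ y (hφ.mem_dom hys), hy, hy', c'.act_mul _ _ _ (hφ.map_mem hys)]

/-- Some element corresponds to `g⁻¹`; multiplicativity and uniqueness force it to be `h⁻¹`. -/
lemma inv (H : Intertwines c c' φ x g h) (hφ : IsTransition c c' φ) (hx : x ∈ φ.source)
    (hg : c.act g x = x) : Intertwines c c' φ x g⁻¹ h⁻¹ := by
  have hg' : c.act g⁻¹ x = x := c.act_inv_eq (hφ.mem_dom hx) hg
  obtain ⟨k, -, hk⟩ := hφ.exists_conj hx hg'
  have h1 := mul hk H hφ hx hg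
  rw [inv_mul_cancel] at h1
  rw [← eq_inv_of_mul_eq_one_left (h1.unique (one hφ hx) hφ hx)]
  exact hk

lemma pow (H : Intertwines c c' φ x g h) (hφ : IsTransition c c' φ) (hx : x ∈ φ.source)
    (hg : c.act g x = x) (m : ℕ) : Intertwines c c' φ x (g ^ m) (h ^ m) := by
  induction m with
  | zero => simpa using one hφ hx
  | succ m ih =>
    rw [pow_succ, pow_succ]
    exact ih.mul H hφ hx hg

lemma orderOf_eq (H : Intertwines c c' φ x g h) (hφ : IsTransition c c' φ) (hx : x ∈ φ.source)
    (hg : c.act g x = x) : orderOf g = orderOf h := by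
  refine orderOf_eq_orderOf_iff.2 fun m => ⟨fun hm => ?_, fun hm => ?_⟩
  · have h1 := H.pow hφ hx hg m
    rw [hm] at h1
    exact h1.unique (one hφ hx) hφ hx
  · have h1 := (H.symm hφ hx hg).pow hφ.symm (φ.map_source hx) (H.act_apply hg) m
    rw [hm] at h1
    exact h1.unique (one hφ.symm (φ.map_source hx)) hφ.symm (φ.map_source hx)

end Intertwines

lemma Chart.intertwines_actHomeo (c : Chart n X) {x : Cn n} (hx : x ∈ c.dom) {g h k : c.G}
    (hk : k * g = h * k) : Intertwines c c (c.actHomeo k) x g h := by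
  filter_upwards [c.isOpen_dom.mem_nhds hx] with y hy
  change c.act k (c.act g y) = c.act h (c.act k y)
  rw [← c.act_mul _ _ y hy, hk, c.act_mul _ _ y hy]

/-- The two products have the same germ at `x`. This turns a local relation between maps into a
conjugacy relation in the group. -/
lemma Chart.mul_eq_mul_of_intertwines (c : Chart n X) {φ : OpenPartialHomeomorph (Cn n) (Cn n)}
    {x : Cn n} (hx : x ∈ c.dom) {g h k : c.G} (hg : c.act g x = x) (hk : φ =ᶠ[𝓝 x] c.act k)
    (H : Intertwines c c φ x g h) : k * g = h * k := by
  refine c.eq_of_eventuallyEq hx ?_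
  have h2 : Tendsto (c.act g) (𝓝 x) (𝓝 x) := by
    have := c.continuousAt_act g hx
    rwa [ContinuousAt, hg] at this
  filter_upwards [h2.eventually hk, hk, H, c.isOpen_dom.mem_nhds hx] with y h1 h2 h3 hy
  rw [c.act_mul _ _ y hy, c.act_mul _ _ y hy, ← h1, h3, h2]

lemma Chart.mem_fix {c : Chart n X} {g : c.G} {x : Cn n} :
    x ∈ c.fix g ↔ x ∈ c.dom ∧ c.act g x = x := Iff.rfl

/-! ### Representatives of the points of `X̃`. -/

namespace Orbifold

variable {O : Orbifold n X}

lemma proj_liftAt (p : X) : (O.chartAt p).1.proj (O.liftAt p) = p :=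
  (O.cover p).choose_spec.choose_spec.2

namespace Represents

variable {c c' : O.atlas} {g : c.1.G} {g' : c'.1.G} {x x' : Cn n} {z w : O.Inertia}

lemma exists_intertwines (h : O.Represents c g x z) :
    ∃ (φ : _) (b : O.localGroup z.1), IsTransition c.1 (O.chartAt z.1).1 φ ∧ x ∈ φ.source ∧
      φ x = O.liftAt z.1 ∧ ConjClasses.mk b = z.2 ∧
      Intertwines c.1 (O.chartAt z.1).1 φ x g b := by
  obtain ⟨-, φ, hφ, hx, hφx, b, hb, H⟩ := h
  exact ⟨φ, b, hφ, hx, hφx, hb, H⟩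

lemma mem_fix (h : O.Represents c g x z) : x ∈ c.1.fix g := h.1

lemma proj_eq (h : O.Represents c g x z) : c.1.proj x = z.1 := by
  obtain ⟨-, φ, hφ, hx, hφx, -⟩ := h
  rw [← hφ.proj_eq x hx, hφx, proj_liftAt]

lemma of_transition {φ : OpenPartialHomeomorph (Cn n) (Cn n)} (hφ : IsTransition c.1 c'.1 φ)
    (hx : x ∈ φ.source) (hg : c.1.act g x = x) (H : Intertwines c.1 c'.1 φ x g g')
    (h : O.Represents c' g' (φ x) z) : O.Represents c g x z := by
  obtain ⟨-, ψ, hψ, hxψ, hψx, k, hk, H'⟩ := h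
  refine ⟨⟨hφ.mem_dom hx, hg⟩, φ.trans ψ, hφ.trans hψ, ?_, hψx, k, hk, H.trans H' hx⟩
  rw [φ.trans_source ψ]
  exact ⟨hx, hxψ⟩

lemma map_transition {φ : OpenPartialHomeomorph (Cn n) (Cn n)} (hφ : IsTransition c.1 c'.1 φ)
    (hx : x ∈ φ.source) (H : Intertwines c.1 c'.1 φ x g g')
    (h : O.Represents c g x z) : O.Represents c' g' (φ x) z := by
  refine of_transition hφ.symm (φ.map_source hx) (H.act_apply h.mem_fix.2)
    (H.symm hφ hx h.mem_fix.2) ?_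
  rwa [φ.left_inv hx]

/-- Two representatives of a point of `X̃` are related by a change of charts. -/
lemma exists_transition (h : O.Represents c g x z) (h' : O.Represents c' g' x' z) :
    ∃ φ, IsTransition c.1 c'.1 φ ∧ x ∈ φ.source ∧ φ x = x' ∧ Intertwines c.1 c'.1 φ x g g' := by
  obtain ⟨hxd, hgx⟩ := h.mem_fix
  obtain ⟨hxd', hgx'⟩ := h'.mem_fix
  obtain ⟨φ, a, hφ, hx, hφx, ha, H⟩ := h.exists_intertwines
  obtain ⟨ψ, b, hψ, hx', hψx', hb, H'⟩ := h'.exists_intertwines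
  -- The two representatives give conjugate, not equal, elements of the local group. The action of
  -- the conjugating `k` is inserted between `φ` and `ψ⁻¹` to correct this.
  obtain ⟨k, hk⟩ := isConj_iff.1 (ConjClasses.mk_eq_mk_iff_isConj.1 (ha.trans hb.symm))
  set l := O.liftAt z.1 with hl
  set d := O.chartAt z.1 with hd
  have hld : l ∈ d.1.dom := O.liftAt_mem z.1
  have hk1 : (k : d.1.G) * a = b * k := by
    rw [← hk]; simp
  set ψ' := (d.1.actHomeo k).trans ψ.symm with hψ'
  have hkl : d.1.act k l = l := k.2
  have hlψ : l ∈ ψ.target := by rw [← hψx']; exact ψ.map_source hx'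
  have hlψ' : l ∈ ψ'.source := by
    rw [hψ', OpenPartialHomeomorph.trans_source]
    refine ⟨hld, ?_⟩
    change d.1.act k l ∈ ψ.target
    rwa [hkl]
  have hψl : ψ.symm l = x' := by rw [← hψx', ψ.left_inv hx']
  have hψ'l : ψ' l = x' := by
    change ψ.symm (d.1.act k l) = x'
    rw [hkl, hψl]
  have hs := H'.symm hψ hx' hgx'
  have h1 : Intertwines d.1 c'.1 ψ' l a g' := by
    refine Intertwines.trans (d.1.intertwines_actHomeo hld hk1) ?_ hld
    change Intertwines d.1 c'.1 ψ.symm (d.1.act k l) b g'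
    rw [hkl, ← hψx']
    exact hs
  have hx1 : x ∈ (φ.trans ψ').source := by
    rw [φ.trans_source ψ']
    refine ⟨hx, ?_⟩
    rw [mem_preimage, hφx]
    exact hlψ'
  refine ⟨φ.trans ψ', hφ.trans ((d.1.isTransition_actHomeo k).trans hψ.symm), hx1, ?_, ?_⟩
  · rw [OpenPartialHomeomorph.coe_trans, Function.comp_apply, hφx, hψ'l]
  · refine Intertwines.trans H ?_ hx
    rw [hφx]
    exact h1

/-- Two changes of charts to the chosen point over `p` differ by an element of `G_p`, which
conjugates one image of `g` to the other. -/
lemma unique (h : O.Represents c g x z) (h' : O.Represents c g x w) : z = w := by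
  have hzw : z.1 = w.1 := by rw [← h.proj_eq, ← h'.proj_eq]
  obtain ⟨p, a⟩ := z
  obtain ⟨q, b⟩ := w
  obtain rfl : p = q := hzw
  obtain ⟨hxd, hgx⟩ := h.mem_fix
  obtain ⟨φ, a, hφ, hx, hφx, ha, H⟩ := h.exists_intertwines
  obtain ⟨ψ, b, hψ, hxψ, hψx, hb, H'⟩ := h'.exists_intertwines
  set l := O.liftAt p with hl
  set d := O.chartAt p with hd
  have hld : l ∈ d.1.dom := O.liftAt_mem p
  dsimp only at a b hφ hφx ha hψ hψx hb H H'
  -- the change of charts `ψ ∘ φ⁻¹` at the chosen point is a group element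
  have hlφ : l ∈ φ.target := by rw [← hφx]; exact φ.map_source hx
  have hφl : φ.symm l = x := by rw [← hφx, φ.left_inv hx]
  have hls : l ∈ (φ.symm.trans ψ).source := by
    rw [φ.symm.trans_source ψ]
    refine ⟨hlφ, ?_⟩
    rw [mem_preimage, hφl]
    exact hxψ
  obtain ⟨k, hk⟩ := (hφ.symm.trans hψ).exists_eventuallyEq_act hls
  have hkl : d.1.act k l = l := by
    rw [← hk.eq_of_nhds, OpenPartialHomeomorph.coe_trans, Function.comp_apply, hφl, hψx]
  have h1 : Intertwines d.1 d.1 (φ.symm.trans ψ) l a b := by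
    have hs := H.symm hφ hx hgx
    rw [hφx] at hs
    refine Intertwines.trans hs ?_ hlφ
    rw [hφl]
    exact H'
  have hka := d.1.mul_eq_mul_of_intertwines hld (show d.1.act a l = l from a.2) hk h1
  have hc : ConjClasses.mk a = ConjClasses.mk b := by
    refine ConjClasses.mk_eq_mk_iff_isConj.2 (isConj_iff.2 ⟨⟨k, hkl⟩, ?_⟩)
    apply Subtype.ext
    change k * a * k⁻¹ = b
    rw [hka, mul_inv_cancel_right]
  rw [ha, hb] at hc
  exact congrArg (Sigma.mk p) hc

lemma invol (h : O.Represents c g x z) : O.Represents c g⁻¹ x (O.invol z) := by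
  obtain ⟨hxd, hgx⟩ := h.mem_fix
  obtain ⟨φ, a, hφ, hx, hφx, ha, H⟩ := h.exists_intertwines
  refine ⟨⟨hxd, c.1.act_inv_eq hxd hgx⟩, φ, hφ, hx, hφx, a⁻¹, ?_, H.inv hφ hx hgx⟩
  unfold Orbifold.invol
  dsimp only
  rw [← ha]
  rfl

end Represents

lemma exists_represents {c : O.atlas} {g : c.1.G} {x : Cn n} (hx : x ∈ c.1.fix g) :
    ∃ z, O.Represents c g x z := by
  obtain ⟨φ, hφ, hxφ, hφx⟩ := O.compatible c (O.chartAt (c.1.proj x)) x hx.1 _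
    (O.liftAt_mem (c.1.proj x)) (proj_liftAt _).symm
  obtain ⟨h, hh, H⟩ := hφ.exists_conj hxφ hx.2
  rw [hφx] at hh
  exact ⟨⟨c.1.proj x, ConjClasses.mk ⟨h, hh⟩⟩, hx, φ, hφ, hxφ, hφx, ⟨h, hh⟩, rfl, H⟩

lemma represents_liftAt (p : X) (a : O.localGroup p) :
    O.Represents (O.chartAt p) a (O.liftAt p) ⟨p, ConjClasses.mk a⟩ := by
  refine ⟨⟨O.liftAt_mem p, a.2⟩, (O.chartAt p).1.actHomeo 1,
    (O.chartAt p).1.isTransition_actHomeo 1, O.liftAt_mem p,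
    (O.chartAt p).1.act_one _ (O.liftAt_mem p), a, rfl,
    (O.chartAt p).1.intertwines_actHomeo (O.liftAt_mem p) (by simp)⟩

/-- This allows all points of `X̃` over one point of `X` to be compared at a single point of a
single chart. -/
lemma exists_represents_of_proj_eq (z : O.Inertia) (c : O.atlas) {x : Cn n} (hx : x ∈ c.1.dom)
    (hxz : c.1.proj x = z.1) : ∃ g, O.Represents c g x z := by
  obtain ⟨p, z⟩ := z
  obtain ⟨a, rfl⟩ := ConjClasses.exists_rep z
  obtain ⟨φ, hφ, hl, hφl⟩ := O.compatible (O.chartAt p) c _ (O.liftAt_mem p) x hx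
    ((proj_liftAt p).trans hxz.symm)
  obtain ⟨g, -, H⟩ := hφ.exists_conj hl (show (O.chartAt p).1.act a (O.liftAt p) = _ from a.2)
  refine ⟨g, ?_⟩
  rw [← hφl]
  exact (represents_liftAt p a).map_transition hφ hl H

lemma exists_rep (z : O.Inertia) : ∃ (c : O.atlas) (g : c.1.G) (x : Cn n), O.Represents c g x z := by
  obtain ⟨g, hg⟩ := exists_represents_of_proj_eq z _ (O.liftAt_mem z.1) (proj_liftAt z.1)
  exact ⟨_, g, _, hg⟩

lemma represents_one (c : O.atlas) {x : Cn n} (hx : x ∈ c.1.dom) :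
    O.Represents c 1 x (O.trivialPt (c.1.proj x)) := by
  obtain ⟨φ, hφ, hxφ, hφx⟩ := O.compatible c (O.chartAt (c.1.proj x)) x hx _
    (O.liftAt_mem (c.1.proj x)) (proj_liftAt _).symm
  exact ⟨⟨hx, c.1.act_one x hx⟩, φ, hφ, hxφ, hφx, 1, rfl, Intertwines.one hφ hxφ⟩

end Orbifold

/-- Every point of `V^g` has a neighbourhood whose intersection with `V^g` is connected. -/
lemma Chart.exists_isPreconnected_inter_fix (c : Chart n X) {g : c.G} {x : Cn n}
    (hx : x ∈ c.fix g) : ∃ N, IsOpen N ∧ x ∈ N ∧ IsPreconnected (N ∩ c.fix g) := by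
  obtain ⟨L, hxL, hLd, -, hLs, hLs', hLc, hL, -⟩ := c.exists_linearization hx.1
  refine ⟨L.source, L.open_source, hxL, ?_⟩
  set E : Submodule ℝ (Cn n) := LinearMap.ker
    ((fderiv ℝ (c.act g) x - ContinuousLinearMap.id ℝ (Cn n) : Cn n →L[ℝ] Cn n) :
      Cn n →ₗ[ℝ] Cn n)
  have hE : ∀ v, v ∈ E ↔ fderiv ℝ (c.act g) x v = v := fun v => by
    simp [E, sub_eq_zero]
  -- In linearizing coordinates the fixed point set is the intersection of a linear subspace with a
  -- convex set.
  have h1 : L.source ∩ c.fix g = L.symm '' (L.target ∩ E) := by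
    ext y
    constructor
    · rintro ⟨hy, hyd, hgy⟩
      refine ⟨L y, ⟨L.map_source hy, (hE _).2 ?_⟩, L.left_inv hy⟩
      rw [← (hL g hx.2 y hy).2, hgy]
    · rintro ⟨v, ⟨hv, hvE⟩, rfl⟩
      have hy := L.map_target hv
      refine ⟨hy, hLd hy, L.injOn (hL g hx.2 _ hy).1 hy ?_⟩
      rw [(hL g hx.2 _ hy).2, L.right_inv hv]
      exact (hE _).1 hvE
  rw [h1]
  exact (hLc.inter E.convex).isPreconnected.image _
    (L.continuousOn_symm.mono inter_subset_left)

/-! ### The topology of `X̃` and of its sectors. -/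

namespace Orbifold

variable {O : Orbifold n X}

/-- The point `(π x, (g))` of `X̃` for `x ∈ V^g`. -/
def pt (c : O.atlas) (g : c.1.G) (x : c.1.fix g) : O.Inertia :=
  (exists_represents x.2).choose

lemma represents_pt (c : O.atlas) (g : c.1.G) (x : c.1.fix g) :
    O.Represents c g x (O.pt c g x) :=
  (exists_represents x.2).choose_spec

lemma Represents.eq_pt {c : O.atlas} {g : c.1.G} {x : Cn n} {z : O.Inertia}
    (h : O.Represents c g x z) : z = O.pt c g ⟨x, h.mem_fix⟩ :=
  h.unique (represents_pt c g ⟨x, h.mem_fix⟩)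

lemma isOpen_iff {U : Set O.Inertia} : IsOpen U ↔ ∀ (c : O.atlas) (g : c.1.G),
    ∃ W : Set (Cn n), IsOpen W ∧ ∀ x z, O.Represents c g x z → (z ∈ U ↔ x ∈ W) := Iff.rfl

lemma continuous_pt (c : O.atlas) (g : c.1.G) : Continuous (O.pt c g) := by
  refine continuous_def.2 fun U hU => ?_
  obtain ⟨W, hW, e⟩ := isOpen_iff.1 hU c g
  have h1 : O.pt c g ⁻¹' U = Subtype.val ⁻¹' W := by
    ext x
    exact e x _ (represents_pt c g x)
  rw [h1]
  exact hW.preimage continuous_subtype_val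

/-- A point of another `V^g'` maps into this set exactly when some change of charts carries it into
`A` and `g'` to `g`. For a fixed change of charts these conditions are open. -/
lemma isOpen_image_represents (c : O.atlas) (g : c.1.G) {A : Set (Cn n)} (hA : IsOpen A) :
    IsOpen {z | ∃ x ∈ A, O.Represents c g x z} := by
  refine isOpen_iff.2 fun c' g' => ⟨{x' | ∃ φ, IsTransition c'.1 c.1 φ ∧ x' ∈ φ.source ∧
    φ x' ∈ A ∧ Intertwines c'.1 c.1 φ x' g' g}, ?_, fun x' z hz => ⟨?_, ?_⟩⟩
  · refine isOpen_iff_mem_nhds.2 ?_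
    rintro x' ⟨φ, hφ, hx', hA', H⟩
    filter_upwards [φ.open_source.mem_nhds hx',
      (φ.continuousAt hx').preimage_mem_nhds (hA.mem_nhds hA'),
      eventually_eventually_nhds.2 H] with y h1 h2 h3 using ⟨φ, hφ, h1, h2, h3⟩
  · rintro ⟨x, hx, hxz⟩
    obtain ⟨φ, hφ, hx', hφx, H⟩ := hz.exists_transition hxz
    exact ⟨φ, hφ, hx', by rwa [hφx], H⟩
  · rintro ⟨φ, hφ, hx', hA', H⟩
    exact ⟨φ x', hA', hz.map_transition hφ hx' H⟩

lemma isOpenMap_pt (c : O.atlas) (g : c.1.G) : IsOpenMap (O.pt c g) := by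
  rintro _ ⟨A, hA, rfl⟩
  convert isOpen_image_represents c g hA using 1
  ext z
  constructor
  · rintro ⟨x, hx, rfl⟩
    exact ⟨x, hx, represents_pt c g x⟩
  · rintro ⟨x, hx, hz⟩
    exact ⟨⟨x, hz.mem_fix⟩, hx, hz.eq_pt.symm⟩

lemma Adjacent.symm {z w : O.Inertia} (h : O.Adjacent z w) : O.Adjacent w z := by
  obtain ⟨c, g, S, hS, hSc, x, hx, y, hy, h1, h2⟩ := h
  exact ⟨c, g, S, hS, hSc, y, hy, x, hx, h2, h1⟩

lemma Adjacent.toT_eq {z w : O.Inertia} (h : O.Adjacent z w) : O.toT z = O.toT w :=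
  Quotient.sound (Relation.EqvGen.rel _ _ h)

/-- Induction principle for the sectors. -/
lemma apply_eq_of_toT_eq {α : Type*} (f : O.Inertia → α)
    (hf : ∀ z w, O.Adjacent z w → f z = f w) {z w : O.Inertia} (h : O.toT z = O.toT w) :
    f z = f w := by
  have h1 : Relation.EqvGen O.Adjacent z w := Quotient.exact h
  clear h
  induction h1 with
  | rel x y h => exact hf _ _ h
  | refl x => rfl
  | symm x y _ ih => exact ih.symm
  | trans x y z _ _ ih ih' => exact ih.trans ih'

/-- The relation is constant on small connected pieces of `V^g`. -/
lemma isOpen_sector (t : O.T) : IsOpen (O.sector t) := by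
  refine isOpen_iff.2 fun c g => ?_
  choose N hN hxN hNc using fun x : c.1.fix g => c.1.exists_isPreconnected_inter_fix x.2
  refine ⟨⋃ x ∈ {x : c.1.fix g | O.pt c g x ∈ O.sector t}, N x,
    isOpen_biUnion fun x _ => hN x, fun x z hz => ⟨fun h => ?_, fun h => ?_⟩⟩
  · refine mem_iUnion₂.2 ⟨⟨x, hz.mem_fix⟩, ?_, hxN _⟩
    change O.pt c g _ ∈ O.sector t
    rwa [← hz.eq_pt]
  · obtain ⟨y, hy, hxy⟩ := mem_iUnion₂.1 h
    have h1 : O.Adjacent z (O.pt c g y) := ⟨c, g, _, inter_subset_right, hNc y, x,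
      ⟨hxy, hz.mem_fix⟩, y, ⟨hxN y, y.2⟩, hz, represents_pt c g y⟩
    exact h1.toT_eq.trans hy

lemma isClosed_sector (t : O.T) : IsClosed (O.sector t) := by
  rw [← isOpen_compl_iff]
  have h1 : (O.sector t)ᶜ = ⋃ s ∈ {s | s ≠ t}, O.sector s := by
    ext z
    simp [sector]
  rw [h1]
  exact isOpen_biUnion fun s _ => isOpen_sector s

lemma connectedComponent_eq_of_toT_eq {z w : O.Inertia} (h : O.toT z = O.toT w) :
    connectedComponent z = connectedComponent w := by
  refine apply_eq_of_toT_eq connectedComponent ?_ h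
  rintro z w ⟨c, g, S, hS, hSc, x, hx, y, hy, hz, hw⟩
  have h1 : IsPreconnected (O.pt c g '' (Subtype.val ⁻¹' S)) :=
    (Topology.IsInducing.subtypeVal.isPreconnected_image.1 (by
      rwa [Subtype.image_preimage_coe, inter_eq_right.2 hS])).image _
      (continuous_pt c g).continuousOn
  refine connectedComponent_eq (h1.subset_connectedComponent ?_ ?_)
  · exact ⟨⟨x, hS hx⟩, hx, hz.eq_pt.symm⟩
  · exact ⟨⟨y, hS hy⟩, hy, hw.eq_pt.symm⟩

/-- One inclusion holds because elementary equivalence preserves components, the other because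
sectors are open and closed. -/
lemma sector_toT (z : O.Inertia) : O.sector (O.toT z) = connectedComponent z := by
  apply Subset.antisymm
  · intro w hw
    rw [← connectedComponent_eq_of_toT_eq hw]
    exact mem_connectedComponent
  · exact IsClopen.connectedComponent_subset ⟨isClosed_sector _, isOpen_sector _⟩ rfl

lemma toT_eq_iff {z w : O.Inertia} :
    O.toT z = O.toT w ↔ connectedComponent z = connectedComponent w := by
  refine ⟨connectedComponent_eq_of_toT_eq, fun h => ?_⟩
  have h1 : z ∈ O.sector (O.toT w) := by
    rw [sector_toT, ← h]
    exact mem_connectedComponent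
  exact h1

lemma exists_toT_eq (t : O.T) : ∃ z, O.toT z = t := Quotient.exists_rep t

lemma isConnected_sector (t : O.T) : IsConnected (O.sector t) := by
  obtain ⟨z, rfl⟩ := exists_toT_eq t
  rw [sector_toT]
  exact isConnected_connectedComponent

lemma continuous_fst : Continuous (fun z : O.Inertia => z.1) := by
  refine continuous_def.2 fun U hU => isOpen_iff.2 fun c g =>
    ⟨c.1.dom ∩ c.1.proj ⁻¹' U, c.1.proj_continuous.isOpen_inter_preimage c.1.isOpen_dom hU,
      fun x z hz => ?_⟩
  rw [mem_preimage, ← hz.proj_eq]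
  exact ⟨fun h => ⟨hz.mem_fix.1, h⟩, fun h => h.2⟩

/-- In each chart the preimage is the image under the open map `proj` of an open set, the one that
describes `U` on the fixed point set of the unit element. -/
lemma continuous_trivialPt : Continuous O.trivialPt := by
  refine continuous_def.2 fun U hU => ?_
  choose W hW e using fun c : O.atlas => isOpen_iff.1 hU c 1
  have h1 : O.trivialPt ⁻¹' U = ⋃ c : O.atlas, c.1.proj '' (c.1.dom ∩ W c) := by
    ext p
    rw [mem_iUnion]
    constructor
    · intro hp
      obtain ⟨c, x, hx, rfl⟩ := O.cover p
      exact ⟨c, x, ⟨hx, (e c x _ (represents_one c hx)).1 hp⟩, rfl⟩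
    · rintro ⟨c, x, ⟨hx, hxW⟩, rfl⟩
      exact (e c x _ (represents_one c hx)).2 hxW
  rw [h1]
  exact isOpen_iUnion fun c =>
    c.1.proj_open _ inter_subset_left (c.1.isOpen_dom.inter (hW c))

lemma toT_trivialPt_eq_iff (p q : X) : O.toT (O.trivialPt p) = O.toT (O.trivialPt q) ↔
    connectedComponent p = connectedComponent q := by
  rw [toT_eq_iff]
  constructor <;> intro h <;> refine connectedComponent_eq ?_
  · refine continuous_fst.image_connectedComponent_subset (O.trivialPt p) ⟨O.trivialPt q, ?_, rfl⟩
    rw [h]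
    exact mem_connectedComponent
  · refine continuous_trivialPt.image_connectedComponent_subset p ⟨q, ?_, rfl⟩
    rw [h]
    exact mem_connectedComponent

/-- Points over different points of `X` are separated in `X`. Points over the same one are
represented at a common `x` by elements `g` and `h`; if their neighbourhoods coming from a small `U`
met, an element of the isotropy group of `x` would conjugate `g` to `h`. -/
instance : T2Space O.Inertia := by
  have := O.t2
  refine ⟨fun z w hzw => ?_⟩
  by_cases h : z.1 = w.1
  · set c := O.chartAt z.1
    have hx := O.liftAt_mem z.1
    set x := O.liftAt z.1
    obtain ⟨g, hg⟩ := exists_represents_of_proj_eq z c hx (proj_liftAt z.1)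
    obtain ⟨h, hh⟩ := exists_represents_of_proj_eq w c hx ((proj_liftAt z.1).trans h)
    obtain ⟨U, hU, hxU, hUd, hUs⟩ := c.1.exists_nhds_act_mem_imp_stab hx
    refine ⟨_, _, isOpen_image_represents c g hU, isOpen_image_represents c h hU,
      ⟨x, hxU, hg⟩, ⟨x, hxU, hh⟩, ?_⟩
    rw [Set.disjoint_left]
    rintro v ⟨y, hy, hyv⟩ ⟨y', hy', hyv'⟩
    obtain ⟨φ, hφ, hyφ, hφy, H⟩ := hyv.exists_transition hyv'
    obtain ⟨k, hk⟩ := hφ.exists_eventuallyEq_act hyφ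
    have hky : c.1.act k y = y' := by rw [← hk.eq_of_nhds, hφy]
    have hkx := hUs k y hy (by rwa [hky])
    have hkg := c.1.mul_eq_mul_of_intertwines (hUd hy) hyv.mem_fix.2 hk H
    have h1 : O.Represents c h (c.1.act k x) z := hg.map_transition
      (c.1.isTransition_actHomeo k) hx (c.1.intertwines_actHomeo hx hkg)
    rw [hkx] at h1
    exact hzw (h1.unique hh)
  · obtain ⟨U, V, hU, hV, hz, hw, hUV⟩ := t2_separation h
    exact ⟨_, _, hU.preimage continuous_fst, hV.preimage continuous_fst, hz, hw,
      hUV.preimage _⟩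

lemma exists_isCompact_nhds (p : X) : ∃ (c : O.atlas) (K : Set (Cn n)) (U : Set X),
    IsCompact K ∧ K ⊆ c.1.dom ∧ IsOpen U ∧ p ∈ U ∧ U ⊆ c.1.proj '' K := by
  obtain ⟨c, x, hx, rfl⟩ := O.cover p
  obtain ⟨K, hK, hxK, hKd⟩ := exists_compact_subset c.1.isOpen_dom hx
  exact ⟨c, K, c.1.proj '' interior K, hK, hKd,
    c.1.proj_open _ (interior_subset.trans hKd) isOpen_interior, mem_image_of_mem _ hxK,
    image_mono interior_subset⟩

/-- Finitely many compact sets `K` in charts cover `X`, and the groups are finite, so `X̃` is a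
finite union of continuous images of the compact sets `K ∩ V^g`. -/
instance [CompactSpace X] : CompactSpace O.Inertia := by
  choose c K U hK hKd hU hpU hUK using exists_isCompact_nhds (O := O)
  obtain ⟨s, hs⟩ := isCompact_univ.elim_finite_subcover U hU
    fun p _ => mem_iUnion.2 ⟨p, hpU p⟩
  have h1 : (univ : Set O.Inertia) =
      ⋃ p ∈ s, ⋃ g : (c p).1.G, O.pt (c p) g '' (Subtype.val ⁻¹' K p) := by
    refine (eq_univ_of_forall fun z => ?_).symm
    obtain ⟨p, hp, hz⟩ := mem_iUnion₂.1 (hs (mem_univ z.1))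
    obtain ⟨x, hx, hxz⟩ := hUK p hz
    obtain ⟨g, hg⟩ := exists_represents_of_proj_eq z (c p) (hKd p hx) hxz
    exact mem_iUnion₂.2 ⟨p, hp, mem_iUnion.2 ⟨g, ⟨x, hg.mem_fix⟩, hx, hg.eq_pt.symm⟩⟩
  refine ⟨?_⟩
  rw [h1]
  refine s.isCompact_biUnion fun p _ => isCompact_iUnion fun g => ?_
  refine IsCompact.image ?_ (continuous_pt _ g)
  rw [Topology.IsInducing.subtypeVal.isCompact_iff, Subtype.image_preimage_coe]
  have h2 : (c p).1.fix g ∩ K p = K p ∩ {x | (c p).1.act g x = x} := by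
    ext x
    exact ⟨fun h => ⟨h.2, h.1.2⟩, fun h => ⟨⟨hKd p h.1, h.2⟩, h.1⟩⟩
  rw [h2]
  have hcl : IsClosed (K p ∩ {x | (c p).1.act g x = x}) := by
    have h3 : K p ∩ {x | (c p).1.act g x = x} =
        K p ∩ (fun x => (c p).1.act g x - x) ⁻¹' {0} := by
      ext x
      simp [sub_eq_zero]
    rw [h3]
    exact ((((c p).1.act_smooth g).continuousOn.mono (hKd p)).sub
      continuousOn_id).preimage_isClosed_of_isClosed (hK p).isClosed isClosed_singleton
  exact (hK p).of_isClosed_subset hcl inter_subset_left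

/-- By compactness finitely many images of sets `V^g` cover `X̃`; each is open and a quotient of
`V^g` by an open map, hence second countable. -/
instance [CompactSpace X] : SecondCountableTopology O.Inertia := by
  have h1 : ∀ z : O.Inertia, ∃ (c : O.atlas) (g : c.1.G), z ∈ range (O.pt c g) := fun z => by
    obtain ⟨c, g, x, hx⟩ := exists_rep z
    exact ⟨c, g, ⟨x, hx.mem_fix⟩, hx.eq_pt.symm⟩
  choose c g hz using h1
  have ho : ∀ z, IsOpen (range (O.pt (c z) (g z))) := fun z => (isOpenMap_pt _ _).isOpen_range
  obtain ⟨s, hs⟩ := isCompact_univ.elim_finite_subcover _ ho fun z _ => mem_iUnion.2 ⟨z, hz z⟩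
  have hsc : ∀ z : s, SecondCountableTopology (range (O.pt (c z) (g z))) := fun z => by
    have hq : IsOpenQuotientMap (rangeFactorization (O.pt (c z) (g z))) :=
      ⟨rangeFactorization_surjective, (continuous_pt _ _).rangeFactorization,
        (isOpenMap_pt _ _).subtype_mk _⟩
    exact hq.isQuotientMap.secondCountableTopology hq.isOpenMap
  exact TopologicalSpace.secondCountableTopology_of_countable_cover (fun z : s => ho z)
    (eq_univ_of_univ_subset (by simpa [iUnion_subtype] using hs))

end Orbifold

/-! ### Complex operators of finite order. -/

section LinearAlgebra

variable {V : Type*} [AddCommGroup V] [Module ℂ V]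

lemma finrank_eigenspace_of_diagonal {ι : Type*} [Fintype ι] (A : Module.End ℂ V)
    (b : Module.Basis ι ℂ V) (c : ι → ℂ) (hb : ∀ i, A (b i) = c i • b i) (μ : ℂ) :
    Module.finrank ℂ (Module.End.eigenspace A μ) = Nat.card {i // c i = μ} := by
  classical
  have hsp : Module.End.eigenspace A μ =
      Submodule.span ℂ (Set.range fun i : {i // c i = μ} => b i) := by
    apply le_antisymm
    · intro v hv
      rw [Module.End.mem_eigenspace_iff] at hv
      rw [← b.sum_repr v]
      refine Submodule.sum_mem _ fun i _ => ?_
      by_cases hi : c i = μ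
      · exact Submodule.smul_mem _ _ (Submodule.subset_span ⟨⟨i, hi⟩, rfl⟩)
      · have h1 : A v = ∑ j, (b.repr v j * c j) • b j := by
          conv_lhs => rw [← b.sum_repr v, map_sum]
          exact Finset.sum_congr rfl fun j _ => by rw [map_smul, hb, smul_smul]
        have h2 := congrArg (fun w => b.repr w i) (h1.symm.trans hv)
        simp only [b.repr_sum_self, map_smul, Finsupp.smul_apply, smul_eq_mul] at h2
        have h3 : b.repr v i * (c i - μ) = 0 := by rw [mul_sub, h2]; ring
        rw [(mul_eq_zero.1 h3).resolve_right (sub_ne_zero.2 hi), zero_smul]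
        exact Submodule.zero_mem _
    · rw [Submodule.span_le]
      rintro _ ⟨⟨i, rfl⟩, rfl⟩
      exact Module.End.mem_eigenspace_iff.2 (hb i)
  rw [hsp, Nat.card_eq_fintype_card]
  exact finrank_span_eq_card (b.linearIndependent.comp _ Subtype.val_injective)

/-- The root of unity `e^{2πik/m}`. -/
def expRoot (m k : ℕ) : ℂ := Complex.exp (2 * Real.pi * Complex.I * (k / m))

lemma expRoot_eq_pow (m k : ℕ) :
    expRoot m k = Complex.exp (2 * Real.pi * Complex.I / m) ^ k := by
  rw [expRoot, ← Complex.exp_nat_mul]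
  congr 1
  ring

lemma expRoot_zero (m : ℕ) : expRoot m 0 = 1 := by simp [expRoot]

lemma expRoot_inj {m k l : ℕ} (hk : k < m) (hl : l < m) (h : expRoot m k = expRoot m l) :
    k = l := by
  rw [expRoot_eq_pow, expRoot_eq_pow] at h
  exact (Complex.isPrimitiveRoot_exp m (by omega)).pow_inj hk hl h

lemma exists_eq_expRoot {m : ℕ} (hm : 0 < m) {μ : ℂ} (h : μ ^ m = 1) :
    ∃ k < m, μ = expRoot m k := by
  have : NeZero m := ⟨hm.ne'⟩
  obtain ⟨k, hk, hk'⟩ := (Complex.isPrimitiveRoot_exp m hm.ne').eq_pow_of_pow_eq_one h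
  exact ⟨k, hk, by rw [expRoot_eq_pow, hk']⟩

/-- An operator of finite order on a finite-dimensional complex vector space is diagonalizable. -/
theorem exists_eigenbasis [FiniteDimensional ℂ V] (A : Module.End ℂ V) {m : ℕ} (hm : 0 < m)
    (hA : A ^ m = 1) : ∃ (b : Module.Basis (Fin (Module.finrank ℂ V)) ℂ V)
      (e : Fin (Module.finrank ℂ V) → ℕ), (∀ i, e i < m) ∧ ∀ i, A (b i) = expRoot m (e i) • b i := by
  classical
  -- The squarefree polynomial `X ^ m - 1` annihilates `A`. Semisimplicity makes generalized
  -- eigenspaces into eigenspaces, and over `ℂ` the former span.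
  have hss : A.IsSemisimple := by
    refine Module.End.isSemisimple_of_squarefree_aeval_eq_zero
      (p := (Polynomial.X ^ m - 1 : Polynomial ℂ)) ?_ ?_
    · refine Polynomial.Separable.squarefree ?_
      have h1 := Polynomial.separable_X_pow_sub_C (1 : ℂ) (n := m)
        (by exact_mod_cast hm.ne') one_ne_zero
      rwa [Polynomial.C_1] at h1
    · simp [hA]
  have hint : DirectSum.IsInternal fun μ : ℂ => Module.End.eigenspace A μ := by
    refine DirectSum.isInternal_submodule_of_iSupIndep_of_iSup_eq_top
      (Module.End.eigenspaces_iSupIndep A) ?_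
    have h1 := Module.End.iSup_maxGenEigenspace_eq_top A
    simpa only [hss.isFinitelySemisimple.maxGenEigenspace_eq_eigenspace] using h1
  let B := hint.collectedBasis fun μ => Module.finBasis ℂ (Module.End.eigenspace A μ)
  have : Fintype (Σ μ : ℂ, Fin (Module.finrank ℂ (Module.End.eigenspace A μ))) :=
    Module.Basis.fintypeIndexOfRankLtAleph0 B (Module.rank_lt_aleph0 ℂ V)
  let σ := Fintype.equivFinOfCardEq (Module.finrank_eq_card_basis B).symm
  have hB : ∀ i, A (B i) = i.1 • B i := fun i =>
    Module.End.mem_eigenspace_iff.1 (hint.collectedBasis_mem _ i)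
  have hpow : ∀ i : (Σ μ : ℂ, Fin (Module.finrank ℂ (Module.End.eigenspace A μ))),
      i.1 ^ m = 1 := by
    intro i
    have h1 : ∀ k : ℕ, (A ^ k) (B i) = i.1 ^ k • B i := by
      intro k
      induction k with
      | zero => simp
      | succ k ih => rw [pow_succ', Module.End.mul_apply, ih, map_smul, hB, smul_smul, pow_succ]
    have h2 := h1 m
    rw [hA, Module.End.one_apply] at h2
    have h3 : (i.1 ^ m - 1) • B i = 0 := by rw [sub_smul, ← h2, one_smul, sub_self]
    exact sub_eq_zero.1 ((smul_eq_zero.1 h3).resolve_right (B.ne_zero i))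
  choose e he he' using fun i => exists_eq_expRoot hm (hpow i)
  refine ⟨B.reindex σ, fun i => e (σ.symm i), fun i => he _, fun i => ?_⟩
  rw [Module.Basis.reindex_apply, hB, ← he']

lemma ageSum_nonneg (A : Module.End ℂ V) (m : ℕ) : 0 ≤ ageSum A m :=
  Finset.sum_nonneg fun _ _ => by positivity

section

variable [FiniteDimensional ℂ V] {A : Module.End ℂ V} {m : ℕ}

/-- In an eigenbasis the determinant is `exp (2πi ∑ eᵢ / m)`, and the exponent is `2πi` times the
age. -/
lemma ageSum_isInt_iff (hm : 0 < m) (hA : A ^ m = 1) :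
    (∃ k : ℤ, ageSum A m = k) ↔ LinearMap.det A = 1 := by
  obtain ⟨b, e, he, hb⟩ := exists_eigenbasis A hm hA
  have hdet : LinearMap.det A = ∏ i, expRoot m (e i) := by
    rw [← LinearMap.det_toMatrix b]
    have h1 : LinearMap.toMatrix b b A = Matrix.diagonal fun i => expRoot m (e i) := by
      ext i j
      rw [LinearMap.toMatrix_apply, hb, map_smul, Finsupp.smul_apply, b.repr_self,
        Matrix.diagonal_apply, Finsupp.single_apply]
      by_cases hij : i = j
      · simp [hij]
      · simp [hij, Ne.symm hij]
    rw [h1, Matrix.det_diagonal]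
  rw [hdet, ageSum_of_diagonal A m b e he hb]
  simp only [expRoot]
  rw [← Complex.exp_sum, ← Finset.mul_sum, Complex.exp_eq_one_iff]
  refine exists_congr fun k => ?_
  have h2 : (2 * Real.pi * Complex.I : ℂ) ≠ 0 := Complex.two_pi_I_ne_zero
  rw [mul_comm (k : ℂ), mul_right_inj' h2, ← Rat.cast_inj (α := ℂ)]
  push_cast
  rfl

lemma ageSum_eq_zero_iff (hm : 0 < m) (hA : A ^ m = 1) : ageSum A m = 0 ↔ A = 1 := by
  obtain ⟨b, e, he, hb⟩ := exists_eigenbasis A hm hA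
  rw [ageSum_of_diagonal A m b e he hb, Finset.sum_eq_zero_iff_of_nonneg fun i _ => by positivity]
  constructor
  · intro h
    refine b.ext fun i => ?_
    have h1 : e i = 0 := by
      have := h i (Finset.mem_univ i)
      rw [div_eq_zero_iff] at this
      exact_mod_cast this.resolve_right (by exact_mod_cast hm.ne')
    rw [hb, h1, expRoot_zero, one_smul, Module.End.one_apply]
  · intro h i _
    have h1 := hb i
    rw [h, Module.End.one_apply] at h1
    have h2 : (expRoot m (e i) - 1) • b i = 0 := by rw [sub_smul, ← h1, one_smul, sub_self]
    have h3 := sub_eq_zero.1 ((smul_eq_zero.1 h2).resolve_right (b.ne_zero i))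
    rw [← expRoot_zero m] at h3
    rw [expRoot_inj (he i) hm h3]
    simp

/-- Constancy of this sum is what upgrades semicontinuity of the multiplicities to local constancy.
-/
lemma sum_finrank_eigenspace (hm : 0 < m) (hA : A ^ m = 1) :
    ∑ k ∈ Finset.range m, Module.finrank ℂ (Module.End.eigenspace A (expRoot m k)) =
      Module.finrank ℂ V := by
  classical
  obtain ⟨b, e, he, hb⟩ := exists_eigenbasis A hm hA
  have h1 : ∀ k ∈ Finset.range m, Module.finrank ℂ (Module.End.eigenspace A (expRoot m k)) =
      (Finset.univ.filter fun i => e i = k).card := by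
    intro k hk
    rw [finrank_eigenspace_of_diagonal A b _ hb, Nat.card_eq_fintype_card, Fintype.card_subtype]
    congr 1
    ext i
    simp only [Finset.mem_filter, Finset.mem_univ, true_and]
    exact ⟨expRoot_inj (he i) (Finset.mem_range.1 hk), fun h => by rw [h]⟩
  rw [Finset.sum_congr rfl h1, ← Finset.card_eq_sum_card_fiberwise
    (fun i _ => Finset.mem_coe.2 (Finset.mem_range.2 (he i))), Finset.card_univ, Fintype.card_fin]

lemma ageSum_add_ageSum_inv (hm : 0 < m) (hA : A ^ m = 1) {A' : Module.End ℂ V}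
    (hA' : A' * A = 1) : ageSum A m + ageSum A' m =
      Module.finrank ℂ V - Module.finrank ℂ (Module.End.eigenspace A 1) := by
  classical
  obtain ⟨b, e, he, hb⟩ := exists_eigenbasis A hm hA
  -- The exponent `0` is its own inverse: `m - 0` would fall outside the range `[0, m)`. Every other
  -- eigenvalue contributes `1` to the sum of the two ages.
  have hb' : ∀ i, A' (b i) = expRoot m (if e i = 0 then 0 else m - e i) • b i := by
    intro i
    have h1 : A' (A (b i)) = b i := by rw [← Module.End.mul_apply, hA', Module.End.one_apply]
    rw [hb, map_smul] at h1
    have h2 : expRoot m (if e i = 0 then 0 else m - e i) * expRoot m (e i) = 1 := by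
      rw [expRoot_eq_pow, expRoot_eq_pow, ← pow_add]
      split_ifs with h
      · simp [h]
      · rw [Nat.sub_add_cancel (he i).le, (Complex.isPrimitiveRoot_exp m hm.ne').pow_eq_one]
    conv_rhs => rw [← h1]
    rw [smul_smul, h2, one_smul]
  rw [ageSum_of_diagonal A m b e he hb, ageSum_of_diagonal A' m b _ (fun i => ?_) hb',
    finrank_eigenspace_of_diagonal A b _ hb, ← Finset.sum_add_distrib]
  · have h1 : ∀ i, ((e i : ℚ) / m + ((if e i = 0 then 0 else m - e i : ℕ) : ℚ) / m) =
        1 - if e i = 0 then 1 else 0 := by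
      intro i
      have hm' : (m : ℚ) ≠ 0 := by exact_mod_cast hm.ne'
      split_ifs with h
      · simp [h]
      · rw [Nat.cast_sub (he i).le]
        field_simp
        ring
    rw [Finset.sum_congr rfl fun i _ => h1 i, Finset.sum_sub_distrib, Finset.sum_boole,
      Nat.card_eq_fintype_card, Fintype.card_subtype]
    simp only [Finset.sum_const, Finset.card_univ, Fintype.card_fin, nsmul_eq_mul, mul_one]
    congr 3
    ext i
    simp only [Finset.mem_filter, Finset.mem_univ, true_and]
    refine ⟨fun h => by rw [h, expRoot_zero], fun h => ?_⟩
    rw [← expRoot_zero m] at h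
    exact expRoot_inj (he i) hm h
  · split_ifs with h
    · exact hm
    · omega

end

end LinearAlgebra

/-! ### Multiplicities of eigenvalues under variation of the complex structure. -/

namespace JSpace

variable {J : Cn n →L[ℝ] Cn n} {hJ : ∀ v, J (J v) = -v}

/-- The identity from `ℂⁿ` to `JSpace`, as a real linear equivalence. -/
def realEquiv : JSpace J hJ ≃ₗ[ℝ] Cn n where
  toFun v := v
  invFun v := v
  map_add' _ _ := rfl
  map_smul' r v := by
    have h : ∀ w : Cn n, (r : ℂ).re • w + (r : ℂ).im • J w = r • w := fun w => by simp
    exact h v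
  left_inv _ := rfl
  right_inv _ := rfl

instance : FiniteDimensional ℂ (JSpace J hJ) := by
  have : FiniteDimensional ℝ (JSpace J hJ) := Module.Finite.equiv (realEquiv (hJ := hJ)).symm
  exact Module.Finite.of_restrictScalars_finite ℝ ℂ _

lemma finrank_eq : Module.finrank ℂ (JSpace J hJ) = n := by
  have h1 := finrank_real_of_complex (JSpace J hJ)
  rw [(realEquiv (hJ := hJ)).finrank_eq, finrank_real_of_complex, finrank_euclideanSpace_fin] at h1
  omega

end JSpace

/-- The real operator `A - (a + b J)`. -/
def subScalar (J A : Cn n →L[ℝ] Cn n) (μ : ℂ) : Cn n →L[ℝ] Cn n :=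
  A - (μ.re • ContinuousLinearMap.id ℝ (Cn n) + μ.im • J)

lemma subScalar_apply (J A : Cn n →L[ℝ] Cn n) (μ : ℂ) (v : Cn n) :
    subScalar J A μ v = A v - (μ.re • v + μ.im • J v) := rfl

/-- The real dimension of the space of eigenvectors of `A` with eigenvalue `μ`. -/
def mult (J A : Cn n →L[ℝ] Cn n) (μ : ℂ) : ℕ :=
  Module.finrank ℝ (LinearMap.ker (subScalar J A μ : Cn n →ₗ[ℝ] Cn n))

lemma mem_ker_subScalar {J A : Cn n →L[ℝ] Cn n} {μ : ℂ} {v : Cn n} :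
    v ∈ LinearMap.ker (subScalar J A μ : Cn n →ₗ[ℝ] Cn n) ↔ A v = μ.re • v + μ.im • J v := by
  rw [LinearMap.mem_ker, ContinuousLinearMap.coe_coe, subScalar_apply, sub_eq_zero]

/-- Real kernels in the fixed space `ℂⁿ` can be compared between points where `J`, and so the
complex structure, differs. -/
lemma mult_eq {J A : Cn n →L[ℝ] Cn n} (hJ : ∀ v, J (J v) = -v) (hA : ∀ v, A (J v) = J (A v))
    (μ : ℂ) : mult J A μ =
      2 * Module.finrank ℂ (Module.End.eigenspace (JSpace.endo (hJ := hJ) A hA) μ) := by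
  rw [← finrank_real_of_complex]
  symm
  let E := (Module.End.eigenspace (JSpace.endo (hJ := hJ) A hA) μ)
  have h1 : ∀ v : JSpace J hJ, v ∈ E ↔
      (JSpace.realEquiv v) ∈ LinearMap.ker (subScalar J A μ : Cn n →ₗ[ℝ] Cn n) := by
    intro v
    rw [mem_ker_subScalar]
    exact Module.End.mem_eigenspace_iff
  refine LinearEquiv.finrank_eq
    { toFun := fun v => ⟨JSpace.realEquiv v.1, (h1 _).1 v.2⟩
      invFun := fun v => ⟨JSpace.realEquiv.symm v.1, (h1 _).2 v.2⟩
      map_add' := fun _ _ => rfl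
      map_smul' := fun r v => Subtype.ext (JSpace.realEquiv.map_smul r v.1)
      left_inv := fun _ => rfl
      right_inv := fun _ => rfl }

/-- `T` is injective and maps eigenvectors to eigenvectors with the same eigenvalue. -/
lemma mult_le_of_intertwines {J A J' A' T T' : Cn n →L[ℝ] Cn n} (hT : ∀ v, T' (T v) = v)
    (hA : ∀ v, T (A v) = A' (T v)) (hJ : ∀ v, T (J v) = J' (T v)) (μ : ℂ) :
    mult J A μ ≤ mult J' A' μ := by
  have h1 : ∀ v ∈ LinearMap.ker (subScalar J A μ : Cn n →ₗ[ℝ] Cn n),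
      (T : Cn n →ₗ[ℝ] Cn n) v ∈ LinearMap.ker (subScalar J' A' μ : Cn n →ₗ[ℝ] Cn n) := by
    intro v hv
    rw [mem_ker_subScalar] at hv ⊢
    rw [ContinuousLinearMap.coe_coe, ← hA, hv, map_add, map_smul, map_smul, hJ]
  refine LinearMap.finrank_le_finrank_of_injective
    (f := (T : Cn n →ₗ[ℝ] Cn n).restrict h1) fun v w hvw => ?_
  have h2 : T v = T w := congrArg Subtype.val hvw
  exact Subtype.ext (by rw [← hT v, h2, hT])

lemma mult_add_finrank_range (J A : Cn n →L[ℝ] Cn n) (μ : ℂ) :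
    Module.finrank ℝ (LinearMap.range (subScalar J A μ : Cn n →ₗ[ℝ] Cn n)) + mult J A μ =
      Module.finrank ℝ (Cn n) :=
  LinearMap.finrank_range_add_finrank_ker _

/-- The multiplicity of an eigenvalue is upper semicontinuous. -/
lemma eventually_mult_le {α : Type*} [TopologicalSpace α] {J A : α → Cn n →L[ℝ] Cn n} {a : α}
    (hJ : ContinuousAt J a) (hA : ContinuousAt A a) (μ : ℂ) :
    ∀ᶠ b in 𝓝 a, mult (J b) (A b) μ ≤ mult (J a) (A a) μ := by
  set r := Module.finrank ℝ (LinearMap.range (subScalar (J a) (A a) μ : Cn n →ₗ[ℝ] Cn n)) with hr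
  -- The rank can only jump up near `a`; by rank-nullity the kernel can only shrink.
  have ho := isOpen_setOfPred_nat_le_rank (𝕜 := ℝ) (E := Cn n) (F := Cn n) r
  have hc : ContinuousAt (fun b => subScalar (J b) (A b) μ) a :=
    hA.sub (continuousAt_const.add (hJ.const_smul μ.im))
  have hmem : subScalar (J a) (A a) μ ∈
      {f : Cn n →L[ℝ] Cn n | (r : Cardinal) ≤ LinearMap.rank (f : Cn n →ₗ[ℝ] Cn n)} := by
    change (r : Cardinal) ≤ LinearMap.rank _
    rw [LinearMap.rank, hr, Module.finrank_eq_rank]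
  filter_upwards [hc.eventually (ho.mem_nhds hmem)] with b hb
  have h1 : r ≤ Module.finrank ℝ
      (LinearMap.range (subScalar (J b) (A b) μ : Cn n →ₗ[ℝ] Cn n)) := by
    have h2 : (r : Cardinal) ≤ LinearMap.rank (subScalar (J b) (A b) μ : Cn n →ₗ[ℝ] Cn n) := hb
    rw [LinearMap.rank, ← Module.finrank_eq_rank] at h2
    exact_mod_cast h2
  have h3 := mult_add_finrank_range (J a) (A a) μ
  have h4 := mult_add_finrank_range (J b) (A b) μ
  omega

lemma Chart.fderiv_act_pow (c : Chart n X) (g : c.G) {x : Cn n} (hx : x ∈ c.fix g) (k : ℕ) :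
    (fderiv ℝ (c.act g) x) ^ k = fderiv ℝ (c.act (g ^ k)) x := by
  induction k with
  | zero => rw [pow_zero, pow_zero, c.fderiv_act_one hx.1]; rfl
  | succ k ih =>
    rw [pow_succ, pow_succ, c.fderiv_act_mul _ _ hx.1, hx.2, ih]
    rfl

/-! ### The degree shift and the dimension as functions on `X̃`. -/

namespace AlmostComplex

variable {O : Orbifold n X} (J : AlmostComplex O)

lemma fderiv_act_comm {c : O.atlas} {g : c.1.G} {x : Cn n} (hx : x ∈ c.1.fix g) (v : Cn n) :
    fderiv ℝ (c.1.act g) x (J.J c x v) = J.J c x (fderiv ℝ (c.1.act g) x v) := by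
  have h := J.act_comm c g x hx.1 v
  rwa [hx.2] at h

/-- The complex linear action of `g` on the tangent space at a point of `V^g`. -/
def tangentMap (c : O.atlas) (g : c.1.G) (x : Cn n) (hx : x ∈ c.1.fix g) :
    Module.End ℂ (JSpace (J.J c x) (J.sq c x (Chart.mem_fix.1 hx).1)) :=
  JSpace.endo (fderiv ℝ (c.1.act g) x) (J.fderiv_act_comm hx)

lemma tangentMap_pow_orderOf {c : O.atlas} {g : c.1.G} {x : Cn n} (hx : x ∈ c.1.fix g) :
    J.tangentMap c g x hx ^ orderOf g = 1 := by
  have h1 : ∀ k : ℕ, ∀ v : Cn n, (J.tangentMap c g x hx ^ k : Module.End ℂ _) v =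
      (fderiv ℝ (c.1.act (g ^ k)) x) v := by
    intro k v
    rw [← c.1.fderiv_act_pow g hx]
    induction k with
    | zero => rfl
    | succ k ih =>
      rw [pow_succ', pow_succ']
      exact congrArg (fderiv ℝ (c.1.act g) x) ih
  ext v
  refine (h1 _ v).trans ?_
  rw [pow_orderOf_eq_one, c.1.fderiv_act_one hx.1]
  rfl

/-- The (real) multiplicity of the eigenvalue `μ` of the derivative of `g` at `x`. -/
def multAt (c : O.atlas) (g : c.1.G) (x : Cn n) (μ : ℂ) : ℕ :=
  mult (J.J c x) (fderiv ℝ (c.1.act g) x) μ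

lemma multAt_eq {c : O.atlas} {g : c.1.G} {x : Cn n} (hx : x ∈ c.1.fix g) (μ : ℂ) :
    J.multAt c g x μ =
      2 * Module.finrank ℂ (Module.End.eigenspace (J.tangentMap c g x hx) μ) :=
  mult_eq _ _ μ

lemma multAt_le_of_transition {c c' : O.atlas} {φ : OpenPartialHomeomorph (Cn n) (Cn n)}
    (hφ : IsTransition c.1 c'.1 φ) {x : Cn n} (hx : x ∈ φ.source) {g : c.1.G} {g' : c'.1.G}
    (hg : c.1.act g x = x) (H : Intertwines c.1 c'.1 φ x g g') (μ : ℂ) :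
    J.multAt c g x μ ≤ J.multAt c' g' (φ x) μ := by
  refine mult_le_of_intertwines (T := fderiv ℝ φ x) (T' := fderiv ℝ φ.symm (φ x))
    (hφ.fderiv_symm_apply hx) (fun v => ?_) (J.transition_comm c c' φ hφ x hx) μ
  have hxd := hφ.mem_dom hx
  have h1 : HasFDerivAt (φ ∘ c.1.act g)
      ((fderiv ℝ φ x).comp (fderiv ℝ (c.1.act g) x)) x := by
    refine HasFDerivAt.comp x ?_ (c.1.differentiableAt_act g hxd).hasFDerivAt
    rw [hg]
    exact (hφ.differentiableAt hx).hasFDerivAt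
  have h2 : HasFDerivAt (c'.1.act g' ∘ φ)
      ((fderiv ℝ (c'.1.act g') (φ x)).comp (fderiv ℝ φ x)) x :=
    (c'.1.differentiableAt_act g' (hφ.map_mem hx)).hasFDerivAt.comp x
      (hφ.differentiableAt hx).hasFDerivAt
  have h3 : φ ∘ c.1.act g =ᶠ[𝓝 x] c'.1.act g' ∘ φ := H
  exact congrArg (fun A : Cn n →L[ℝ] Cn n => A v) ((h3.hasFDerivAt_iff.1 h1).unique h2)

lemma multAt_eq_of_transition {c c' : O.atlas} {φ : OpenPartialHomeomorph (Cn n) (Cn n)}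
    (hφ : IsTransition c.1 c'.1 φ) {x : Cn n} (hx : x ∈ φ.source) {g : c.1.G} {g' : c'.1.G}
    (hg : c.1.act g x = x) (H : Intertwines c.1 c'.1 φ x g g') (μ : ℂ) :
    J.multAt c g x μ = J.multAt c' g' (φ x) μ := by
  refine le_antisymm (J.multAt_le_of_transition hφ hx hg H μ) ?_
  have h1 := J.multAt_le_of_transition hφ.symm (φ.map_source hx) (H.act_apply hg)
    (H.symm hφ hx hg) μ
  rwa [φ.left_inv hx] at h1

lemma multAt_eq_of_represents {c c' : O.atlas} {g : c.1.G} {g' : c'.1.G} {x x' : Cn n}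
    {z : O.Inertia} (h : O.Represents c g x z) (h' : O.Represents c' g' x' z) (μ : ℂ) :
    J.multAt c g x μ = J.multAt c' g' x' μ := by
  obtain ⟨φ, hφ, hx, rfl, H⟩ := h.exists_transition h'
  exact J.multAt_eq_of_transition hφ hx h.mem_fix.2 H μ

lemma _root_.CROrbifold.Orbifold.Represents.orderOf_eq {c c' : O.atlas} {g : c.1.G} {g' : c'.1.G}
    {x x' : Cn n} {z : O.Inertia} (h : O.Represents c g x z) (h' : O.Represents c' g' x' z) :
    orderOf g = orderOf g' := by
  obtain ⟨φ, hφ, hx, rfl, H⟩ := h.exists_transition h'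
  exact H.orderOf_eq hφ hx h.mem_fix.2

lemma sum_multAt {c : O.atlas} {g : c.1.G} {x : Cn n} (hx : x ∈ c.1.fix g) :
    ∑ k ∈ Finset.range (orderOf g), J.multAt c g x (expRoot (orderOf g) k) = 2 * n := by
  rw [Finset.sum_congr rfl fun k _ => J.multAt_eq hx _, ← Finset.mul_sum,
    sum_finrank_eigenspace (orderOf_pos g) (J.tangentMap_pow_orderOf hx), JSpace.finrank_eq]

/-- The multiplicities of the eigenvalues of `g` are locally constant on `V^g`. -/
lemma isLocallyConstant_multAt (c : O.atlas) (g : c.1.G) {k : ℕ} (hk : k < orderOf g) :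
    IsLocallyConstant fun x : c.1.fix g => J.multAt c g x (expRoot (orderOf g) k) := by
  refine (IsLocallyConstant.iff_eventually_eq _).2 fun x => ?_
  have hnhds : c.1.dom ∈ 𝓝 (x : Cn n) := c.1.isOpen_dom.mem_nhds x.2.1
  have hJ : ContinuousAt (fun y : c.1.fix g => J.J c y) x :=
    ContinuousAt.comp (f := Subtype.val) ((J.smooth c).continuousOn.continuousAt hnhds)
      continuous_subtype_val.continuousAt
  have hA : ContinuousAt (fun y : c.1.fix g => fderiv ℝ (c.1.act g) y) x :=
    ContinuousAt.comp (f := Subtype.val) ((c.1.continuousOn_fderiv_act g).continuousAt hnhds)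
      continuous_subtype_val.continuousAt
  have h1 : ∀ᶠ y : c.1.fix g in 𝓝 x, ∀ j ∈ Finset.range (orderOf g),
      J.multAt c g y (expRoot (orderOf g) j) ≤ J.multAt c g x (expRoot (orderOf g) j) :=
    (Finset.eventually_all _).2 fun j _ => eventually_mult_le hJ hA _
  filter_upwards [h1] with y hy
  -- No multiplicity at `y` exceeds the one at `x`, while both families sum to `2n`; hence they
  -- agree term by term.
  exact (Finset.sum_eq_sum_iff_of_le hy).1
    ((J.sum_multAt y.2).trans (J.sum_multAt x.2).symm) k (Finset.mem_range.2 hk)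

lemma multAt_eq_of_isPreconnected {c : O.atlas} {g : c.1.G} {S : Set (Cn n)} (hS : S ⊆ c.1.fix g)
    (hSc : IsPreconnected S) {x y : Cn n} (hx : x ∈ S) (hy : y ∈ S) {k : ℕ}
    (hk : k < orderOf g) : J.multAt c g x (expRoot (orderOf g) k) =
      J.multAt c g y (expRoot (orderOf g) k) := by
  have h1 : IsPreconnected (Subtype.val ⁻¹' S : Set (c.1.fix g)) :=
    Topology.IsInducing.subtypeVal.isPreconnected_image.1 (by
      rwa [Subtype.image_preimage_coe, inter_eq_right.2 hS])
  exact (J.isLocallyConstant_multAt c g hk).apply_eq_of_isPreconnected h1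
    (x := ⟨x, hS hx⟩) (y := ⟨y, hS hy⟩) hx hy

/-- The age now depends only on the order and on the real multiplicities, halved to complex ones;
both are invariant under changes of charts. -/
lemma ageSum_eq {c : O.atlas} {g : c.1.G} {x : Cn n} (hx : x ∈ c.1.fix g) :
    ageSum (J.tangentMap c g x hx) (orderOf g) = ∑ k ∈ Finset.range (orderOf g),
      (k / orderOf g : ℚ) * (J.multAt c g x (expRoot (orderOf g) k) / 2 : ℚ) := by
  refine Finset.sum_congr rfl fun k _ => ?_
  rw [J.multAt_eq hx]
  push_cast
  rw [mul_div_cancel_left₀ _ (two_ne_zero' ℚ)]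
  rfl

lemma shift_mk (p : X) (a : O.localGroup p) :
    J.shift ⟨p, ConjClasses.mk a⟩ = ageSum (J.isotropy p a) (orderOf a) := rfl

lemma shift_eq {c : O.atlas} {g : c.1.G} {x : Cn n} {z : O.Inertia} (h : O.Represents c g x z) :
    J.shift z = ageSum (J.tangentMap c g x h.mem_fix) (orderOf g) := by
  obtain ⟨p, z⟩ := z
  obtain ⟨a, rfl⟩ := ConjClasses.exists_rep z
  have h' := Orbifold.represents_liftAt p a
  have h1 : J.shift ⟨p, ConjClasses.mk a⟩ =
      ageSum (J.tangentMap (O.chartAt p) a (O.liftAt p) h'.mem_fix) (orderOf (a : (O.chartAt p).1.G)) := by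
    rw [J.shift_mk, Subgroup.orderOf_coe]
    rfl
  rw [h1, J.ageSum_eq, J.ageSum_eq, h.orderOf_eq h']
  refine Finset.sum_congr rfl fun k _ => ?_
  rw [J.multAt_eq_of_represents h h']

lemma shift_eq_of_adjacent {z w : O.Inertia} (h : O.Adjacent z w) : J.shift z = J.shift w := by
  obtain ⟨c, g, S, hS, hSc, x, hx, y, hy, hz, hw⟩ := h
  rw [J.shift_eq hz, J.shift_eq hw, J.ageSum_eq, J.ageSum_eq]
  refine Finset.sum_congr rfl fun k hk => ?_
  rw [J.multAt_eq_of_isPreconnected hS hSc hx hy (Finset.mem_range.1 hk)]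

/-- The complex dimension of the fixed point sets that represent a neighbourhood of a point of
`X̃`. -/
def fixDim (z : O.Inertia) : ℕ :=
  have h := Orbifold.exists_rep z
  J.multAt h.choose h.choose_spec.choose h.choose_spec.choose_spec.choose 1 / 2

lemma two_mul_fixDim {c : O.atlas} {g : c.1.G} {x : Cn n} {z : O.Inertia}
    (h : O.Represents c g x z) : 2 * J.fixDim z = J.multAt c g x 1 := by
  have h' := (Orbifold.exists_rep z).choose_spec.choose_spec.choose_spec
  rw [fixDim, J.multAt_eq_of_represents h h', J.multAt_eq h'.mem_fix,
    Nat.mul_div_cancel_left _ two_pos]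

/-- The tangent space of `V^g` is the eigenspace of `1`, whose multiplicity is the case `k = 0` of
the constancy along `V^g`. -/
lemma fixDim_eq_of_adjacent {z w : O.Inertia} (h : O.Adjacent z w) :
    J.fixDim z = J.fixDim w := by
  obtain ⟨c, g, S, hS, hSc, x, hx, y, hy, hz, hw⟩ := h
  have h1 := J.multAt_eq_of_isPreconnected hS hSc hx hy (orderOf_pos g)
  rw [expRoot_zero, ← J.two_mul_fixDim hz, ← J.two_mul_fixDim hw] at h1
  omega

lemma tangentMap_inv_mul {c : O.atlas} {g : c.1.G} {x : Cn n} (hx : x ∈ c.1.fix g)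
    (hx' : x ∈ c.1.fix g⁻¹) : J.tangentMap c g⁻¹ x hx' * J.tangentMap c g x hx = 1 := by
  ext v
  have h1 := c.1.fderiv_act_inv_apply g hx.1 v
  rw [hx.2] at h1
  exact h1

lemma shift_add_shift_invol (z : O.Inertia) :
    J.shift z + J.shift (O.invol z) = (n : ℚ) - (J.fixDim z : ℚ) := by
  obtain ⟨c, g, x, h⟩ := Orbifold.exists_rep z
  have h1 := ageSum_add_ageSum_inv (orderOf_pos g) (J.tangentMap_pow_orderOf h.mem_fix)
    (J.tangentMap_inv_mul h.mem_fix h.invol.mem_fix)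
  have h2 := J.two_mul_fixDim h
  rw [J.multAt_eq h.mem_fix] at h2
  rw [J.shift_eq h, J.shift_eq h.invol, orderOf_inv, h1, JSpace.finrank_eq,
    Nat.eq_of_mul_eq_mul_left two_pos h2]

lemma shift_nonneg (z : O.Inertia) : 0 ≤ J.shift z := by
  obtain ⟨c, g, x, h⟩ := Orbifold.exists_rep z
  rw [J.shift_eq h]
  exact ageSum_nonneg _ _

/-- Age zero means that `dg` is the identity, so `g = 1` by rigidity. Conversely the order of a
representative depends only on the point of `X̃`. -/
lemma shift_eq_zero_iff (z : O.Inertia) : J.shift z = 0 ↔ z = O.trivialPt z.1 := by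
  obtain ⟨c, g, x, h⟩ := Orbifold.exists_rep z
  have h0 := Orbifold.represents_one c h.mem_fix.1
  rw [h.proj_eq] at h0
  rw [J.shift_eq h, ageSum_eq_zero_iff (orderOf_pos g) (J.tangentMap_pow_orderOf h.mem_fix)]
  constructor
  · intro h1
    have h2 : g = 1 := by
      refine c.1.eq_one_of_fderiv_eq_id h.mem_fix.1 h.mem_fix.2 ?_
      ext1 v
      exact congrArg (fun A : Module.End ℂ (JSpace (J.J c x) _) => A v) h1
    subst h2
    exact h.unique h0
  · intro h1
    rw [h1] at h
    have h2 : g = 1 := by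
      rw [← orderOf_eq_one_iff, h.orderOf_eq h0, orderOf_one]
    subst h2
    ext v
    change fderiv ℝ (c.1.act 1) x v = v
    rw [c.1.fderiv_act_one h.mem_fix.1]
    rfl

lemma shift_isInt_iff : (∀ z, ∃ k : ℤ, J.shift z = k) ↔
    ∀ p, ∀ g : O.localGroup p, LinearMap.det (J.isotropy p g) = 1 := by
  have key : ∀ p, ∀ a : O.localGroup p, (∃ k : ℤ, J.shift ⟨p, ConjClasses.mk a⟩ = k) ↔
      LinearMap.det (J.isotropy p a) = 1 := by
    intro p a
    rw [J.shift_mk]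
    refine ageSum_isInt_iff (orderOf_pos a) ?_
    rw [← map_pow, pow_orderOf_eq_one, map_one]
  constructor
  · exact fun h p g => (key p g).1 (h _)
  · rintro h ⟨p, z⟩
    obtain ⟨a, rfl⟩ := ConjClasses.exists_rep z
    exact (key p a).2 (h p a)

end AlmostComplex

namespace Orbifold

variable {O : Orbifold n X}

lemma Adjacent.invol {z w : O.Inertia} (h : O.Adjacent z w) :
    O.Adjacent (O.invol z) (O.invol w) := by
  obtain ⟨c, g, S, hS, hSc, x, hx, y, hy, hz, hw⟩ := h
  exact ⟨c, g⁻¹, S, fun v hv => ⟨(hS hv).1, c.1.act_inv_eq (hS hv).1 (hS hv).2⟩, hSc, x, hx, y, hy,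
    hz.invol, hw.invol⟩

end Orbifold

/-! ### Slices of the fixed point sets. -/

/-- A smooth parametrization `incl`, by a domain in `ℂᵈ`, of the part of a fixed point set `V^g` in a
neighbourhood `nhd` of a point `center`, with a smooth inverse `retr`. The neighbourhood is invariant
under the isotropy group of `center` and disjoint from its other translates. -/
structure Slice (O : Orbifold n X) (t : O.T) (d : ℕ) where
  chart : O.atlas
  elt : chart.1.G
  center : Cn n
  nhd : Set (Cn n)
  isOpen_nhd : IsOpen nhd
  nhd_subset : nhd ⊆ chart.1.dom
  center_mem : center ∈ nhd
  dom : Set (Cn d)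
  isOpen_dom : IsOpen dom
  isConnected_dom : IsConnected dom
  incl : Cn d → Cn n
  retr : Cn n → Cn d
  incl_smooth : ContDiffOn ℝ ∞ incl dom
  retr_smooth : ContDiffOn ℝ ∞ retr nhd
  incl_mem_nhd : ∀ w ∈ dom, incl w ∈ nhd
  incl_mem_fix : ∀ w ∈ dom, incl w ∈ chart.1.fix elt
  retr_mem : ∀ y ∈ nhd, y ∈ chart.1.fix elt → retr y ∈ dom
  retr_incl : ∀ w ∈ dom, retr (incl w) = w
  incl_retr : ∀ y ∈ nhd, y ∈ chart.1.fix elt → incl (retr y) = y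
  act_mem_nhd : ∀ h, chart.1.act h center = center → ∀ y ∈ nhd, chart.1.act h y ∈ nhd
  act_center : ∀ h, ∀ y ∈ nhd, chart.1.act h y ∈ nhd → chart.1.act h center = center
  fderiv_incl_fderiv_retr : ∀ w ∈ dom, ∀ u, fderiv ℝ (chart.1.act elt) (incl w) u = u →
    fderiv ℝ incl w (fderiv ℝ retr (incl w) u) = u
  mem_sector : ∀ w ∈ dom, ∀ z, O.Represents chart elt (incl w) z → z ∈ O.sector t

namespace AlmostComplex

variable {O : Orbifold n X} (J : AlmostComplex O)

/-- In linearizing coordinates `L` the set `V^g` is the fixed space `E` of `dg`. With a real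
isomorphism of `ℂᵈ` onto `E`, viewed as an injection `i` into `ℂⁿ`, and a linear left inverse `p` of
`i`, the parametrization is `L⁻¹ ∘ i` and its inverse `p ∘ L`. -/
theorem exists_slice (z : O.Inertia) : ∃ s : Slice O (O.toT z) (J.fixDim z),
    ∃ w ∈ s.dom, O.Represents s.chart s.elt (s.incl w) z := by
  obtain ⟨c, g, x, hz⟩ := Orbifold.exists_rep z
  set d := J.fixDim z with hd
  obtain ⟨hx, hgx⟩ := hz.mem_fix
  obtain ⟨L, hxL, hLd, hL0, hLs, hLs', hLc, hL, hLst⟩ := c.1.exists_linearization hx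
  set A := fderiv ℝ (c.1.act g) x with hA
  -- Writing the fixed space as the kernel that defines `mult` makes its real dimension `2d` by
  -- definition of `fixDim`.
  set E : Submodule ℝ (Cn n) :=
    LinearMap.ker (subScalar (J.J c x) A 1 : Cn n →ₗ[ℝ] Cn n) with hE
  have hmE : ∀ v, v ∈ E ↔ A v = v := fun v => by
    rw [hE, mem_ker_subScalar]
    simp
  have hdim : Module.finrank ℝ (Cn d) = Module.finrank ℝ E := by
    rw [finrank_real_of_complex, finrank_euclideanSpace_fin]
    exact J.two_mul_fixDim hz
  let e : Cn d ≃L[ℝ] E := ContinuousLinearEquiv.ofFinrankEq hdim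
  let i : Cn d →L[ℝ] Cn n := E.subtypeL.comp (e : Cn d →L[ℝ] E)
  have hiE : ∀ v, A (i v) = i v := fun v => (hmE _).1 (e v).2
  have hEi : ∀ u, A u = u → ∃ v, i v = u := fun u hu =>
    ⟨e.symm ⟨u, (hmE u).2 hu⟩, by simp [i]⟩
  have hii : Function.Injective i := Subtype.val_injective.comp e.injective
  obtain ⟨q, hq⟩ := LinearMap.exists_leftInverse_of_injective (i : Cn d →ₗ[ℝ] Cn n)
    (LinearMap.ker_eq_bot.2 hii)
  let p : Cn n →L[ℝ] Cn d := q.toContinuousLinearMap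
  have hpi : ∀ v, p (i v) = v := fun v => congrArg (fun B : Cn d →ₗ[ℝ] Cn d => B v) hq
  have hip : ∀ u, A u = u → i (p u) = u := fun u hu => by
    obtain ⟨v, rfl⟩ := hEi u hu
    rw [hpi]
  set D : Set (Cn d) := i ⁻¹' L.target with hD
  have hDo : IsOpen D := L.open_target.preimage i.continuous
  have h0D : (0 : Cn d) ∈ D := by
    have h1 := L.map_source hxL
    rw [hL0] at h1
    rwa [hD, mem_preimage, map_zero]
  have hDc : Convex ℝ D := hLc.linear_preimage i.toLinearMap
  have hfixL : ∀ y ∈ L.source, (y ∈ c.1.fix g ↔ A (L y) = L y) := by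
    intro y hy
    obtain ⟨h1, h2⟩ := hL g hgx y hy
    rw [← h2]
    exact ⟨fun h => by rw [h.2], fun h => ⟨hLd hy, L.injOn h1 hy h⟩⟩
  have hmem : ∀ w ∈ D, L.symm (i w) ∈ L.source := fun w hw => L.map_target hw
  have hLi : ∀ w ∈ D, L (L.symm (i w)) = i w := fun w hw => L.right_inv hw
  have hfix : ∀ w ∈ D, L.symm (i w) ∈ c.1.fix g := fun w hw =>
    (hfixL _ (hmem w hw)).2 (by rw [hLi w hw, hiE])
  have hsm : ContDiffOn ℝ ∞ (fun w => L.symm (i w)) D :=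
    hLs'.comp i.contDiff.contDiffOn fun w hw => hw
  have hx0 : L.symm (i 0) = x := by rw [map_zero, ← hL0, L.left_inv hxL]
  refine ⟨{ chart := c, elt := g, center := x, nhd := L.source, isOpen_nhd := L.open_source
            nhd_subset := hLd, center_mem := hxL, dom := D, isOpen_dom := hDo
            isConnected_dom := ⟨⟨0, h0D⟩, hDc.isPreconnected⟩
            incl := fun w => L.symm (i w), retr := fun y => p (L y)
            incl_smooth := hsm, retr_smooth := p.contDiff.comp_contDiffOn hLs
            incl_mem_nhd := hmem, incl_mem_fix := hfix
            retr_mem := fun y hy hyf => ?_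
            retr_incl := fun w hw => ?_
            incl_retr := fun y hy hyf => ?_
            act_mem_nhd := fun h hh y hy => (hL h hh y hy).1
            act_center := hLst
            fderiv_incl_fderiv_retr := fun w hw u hu => ?_
            mem_sector := fun w hw z' hz' => ?_ }, 0, h0D, ?_⟩
  · change i (p (L y)) ∈ L.target
    rw [hip _ ((hfixL y hy).1 hyf)]
    exact L.map_source hy
  · rw [hLi w hw, hpi]
  · rw [hip _ ((hfixL y hy).1 hyf), L.left_inv hy]
  · set y := L.symm (i w) with hy
    have hys : y ∈ L.source := hmem w hw
    have hyf : y ∈ c.1.fix g := hfix w hw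
    have hLy : HasFDerivAt L (fderiv ℝ L y) y :=
      ((hLs.contDiffAt (L.open_source.mem_nhds hys)).differentiableAt (by simp)).hasFDerivAt
    have hLi' : L y = i w := hLi w hw
    have hLsy : HasFDerivAt L.symm (fderiv ℝ L.symm (i w)) (i w) :=
      ((hLs'.contDiffAt (L.open_target.mem_nhds hw)).differentiableAt (by simp)).hasFDerivAt
    -- the derivative of `L` intertwines that of `g` with `A`
    have h1 : HasFDerivAt (L ∘ c.1.act g) ((fderiv ℝ L y).comp (fderiv ℝ (c.1.act g) y)) y := by
      refine HasFDerivAt.comp y ?_ (c.1.differentiableAt_act g hyf.1).hasFDerivAt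
      rwa [hyf.2]
    have h2 : HasFDerivAt (A ∘ L) (A.comp (fderiv ℝ L y)) y := A.hasFDerivAt.comp y hLy
    have h3 : L ∘ c.1.act g =ᶠ[𝓝 y] A ∘ L := by
      filter_upwards [L.open_source.mem_nhds hys] with y' hy' using (hL g hgx y' hy').2
    have h4 := congrArg (fun B : Cn n →L[ℝ] Cn n => B u) ((h3.hasFDerivAt_iff.1 h1).unique h2)
    simp only [ContinuousLinearMap.comp_apply, hu] at h4
    -- A vector fixed by the derivative of `g` at `y` is sent by `dL` into `E`, so it is tangent to
    -- the slice and survives the projection `p`.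
    obtain ⟨v, hv⟩ := hEi _ h4.symm
    have h5 : fderiv ℝ (fun y => p (L y)) y u = v := by
      have h6 : HasFDerivAt (p ∘ L) (p.comp (fderiv ℝ L y)) y := p.hasFDerivAt.comp y hLy
      have h7 := h6.fderiv
      change fderiv ℝ (p ∘ L) y u = v
      rw [h7, ContinuousLinearMap.comp_apply, ← hv, hpi]
    rw [h5]
    have h6 : HasFDerivAt (L.symm ∘ i) ((fderiv ℝ L.symm (i w)).comp i) w :=
      hLsy.comp w i.hasFDerivAt
    change fderiv ℝ (L.symm ∘ i) w v = u
    rw [h6.fderiv, ContinuousLinearMap.comp_apply, hv]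
    have h7 : HasFDerivAt (L.symm ∘ L) ((fderiv ℝ L.symm (i w)).comp (fderiv ℝ L y)) y := by
      refine HasFDerivAt.comp y ?_ hLy
      rwa [hLi']
    have h8 : L.symm ∘ L =ᶠ[𝓝 y] id := by
      filter_upwards [L.open_source.mem_nhds hys] with y' hy' using L.left_inv hy'
    exact congrArg (fun B : Cn n →L[ℝ] Cn n => B u)
      ((h8.hasFDerivAt_iff.1 h7).unique (hasFDerivAt_id y))
  -- The slice is the image of a convex set containing `0`, which maps to `x`.
  · have h1 : O.Adjacent z' z := by
      refine ⟨c, g, (fun w => L.symm (i w)) '' D, ?_,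
        hDc.isPreconnected.image _ hsm.continuousOn, _, ⟨w, hw, rfl⟩, x, ⟨0, h0D, hx0⟩, hz', hz⟩
      rintro _ ⟨w, hw, rfl⟩
      exact hfix w hw
    exact h1.toT_eq
  · change O.Represents c g (L.symm (i 0)) z
    rwa [hx0]

end AlmostComplex

/-! ### The uniformizing system of a sector given by a slice. -/

namespace Slice

variable {O : Orbifold n X} {t : O.T} {d : ℕ} (s : Slice O t d)

/-- The elements of the isotropy group of the center that commute with `g`. -/
def centralizer : Subgroup s.chart.1.G :=
  s.chart.1.stab (s.nhd_subset s.center_mem) ⊓ Subgroup.centralizer {s.elt}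

lemma mem_centralizer {h : s.chart.1.G} : h ∈ s.centralizer ↔
    s.chart.1.act h s.center = s.center ∧ h * s.elt = s.elt * h := by
  rw [centralizer, Subgroup.mem_inf, Subgroup.mem_centralizer_singleton_iff]
  exact Iff.rfl

lemma act_mem_fix {h : s.chart.1.G} (hh : h * s.elt = s.elt * h) {y : Cn n}
    (hy : y ∈ s.chart.1.fix s.elt) : s.chart.1.act h y ∈ s.chart.1.fix s.elt := by
  refine ⟨s.chart.1.act_mem h y hy.1, ?_⟩
  rw [← s.chart.1.act_mul _ _ y hy.1, ← hh, s.chart.1.act_mul _ _ y hy.1, hy.2]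

/-- The action of the centralizer on the slice. -/
def move (h : s.chart.1.G) (w : Cn d) : Cn d := s.retr (s.chart.1.act h (s.incl w))

lemma move_mem {h : s.chart.1.G} (hh : h ∈ s.centralizer) {w : Cn d} (hw : w ∈ s.dom) :
    s.move h w ∈ s.dom :=
  s.retr_mem _ (s.act_mem_nhd h (s.mem_centralizer.1 hh).1 _ (s.incl_mem_nhd w hw))
    (s.act_mem_fix (s.mem_centralizer.1 hh).2 (s.incl_mem_fix w hw))

lemma incl_move {h : s.chart.1.G} (hh : h ∈ s.centralizer) {w : Cn d} (hw : w ∈ s.dom) :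
    s.incl (s.move h w) = s.chart.1.act h (s.incl w) :=
  s.incl_retr _ (s.act_mem_nhd h (s.mem_centralizer.1 hh).1 _ (s.incl_mem_nhd w hw))
    (s.act_mem_fix (s.mem_centralizer.1 hh).2 (s.incl_mem_fix w hw))

lemma contDiffOn_move {h : s.chart.1.G} (hh : h ∈ s.centralizer) :
    ContDiffOn ℝ ∞ (s.move h) s.dom := by
  refine s.retr_smooth.comp ((s.chart.1.act_smooth h).comp s.incl_smooth fun w hw =>
    (s.incl_mem_fix w hw).1) fun w hw => ?_
  exact s.act_mem_nhd h (s.mem_centralizer.1 hh).1 _ (s.incl_mem_nhd w hw)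

instance : MulAction s.centralizer s.dom where
  smul h w := ⟨s.move h w, s.move_mem h.2 w.2⟩
  one_smul w := Subtype.ext (by
    change s.retr (s.chart.1.act 1 (s.incl w)) = w
    rw [s.chart.1.act_one _ (s.incl_mem_fix w w.2).1, s.retr_incl w w.2])
  mul_smul h k w := Subtype.ext (by
    change s.retr (s.chart.1.act (h * k) (s.incl w)) =
      s.retr (s.chart.1.act h (s.incl (s.move k w)))
    rw [s.incl_move k.2 w.2, s.chart.1.act_mul _ _ _ (s.incl_mem_fix w w.2).1])

/-- The point of the sector that is represented by a point of the slice. -/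
def toSector (w : s.dom) : O.sector t :=
  ⟨O.pt s.chart s.elt ⟨s.incl w, s.incl_mem_fix w w.2⟩,
    s.mem_sector w w.2 _
      (Orbifold.represents_pt s.chart s.elt ⟨s.incl w, s.incl_mem_fix w w.2⟩)⟩

lemma represents_toSector (w : s.dom) :
    O.Represents s.chart s.elt (s.incl w) (s.toSector w).1 :=
  Orbifold.represents_pt s.chart s.elt ⟨s.incl w, s.incl_mem_fix w w.2⟩

lemma continuous_toSector : Continuous s.toSector := by
  have h1 : Continuous fun w : s.dom =>
      (⟨s.incl w, s.incl_mem_fix w w.2⟩ : s.chart.1.fix s.elt) :=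
    Continuous.subtype_mk
      (continuousOn_iff_continuous_domRestrict.1 s.incl_smooth.continuousOn) _
  exact Continuous.subtype_mk ((Orbifold.continuous_pt s.chart s.elt).comp h1) _

/-- Two points of the slice with the same image are related by a change of charts, locally the
action of some `k`. It commutes with `elt` by intertwining, and it fixes the center because it
carries a point of `nhd` into `nhd`. Conversely the action of such an element is itself a change of
charts. -/
lemma toSector_eq_iff (w w' : s.dom) : s.toSector w = s.toSector w' ↔
    ∃ h ∈ s.centralizer, s.move h w = w' := by
  constructor
  · intro hww'
    have hw := s.represents_toSector w
    have hw' := s.represents_toSector w'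
    rw [← hww'] at hw'
    obtain ⟨φ, hφ, hx, hφx, H⟩ := hw.exists_transition hw'
    obtain ⟨k, hk⟩ := hφ.exists_eventuallyEq_act hx
    have hkw : s.chart.1.act k (s.incl w) = s.incl w' := by rw [← hk.eq_of_nhds, hφx]
    refine ⟨k, s.mem_centralizer.2 ⟨s.act_center k _ (s.incl_mem_nhd w w.2) ?_,
      s.chart.1.mul_eq_mul_of_intertwines hw.mem_fix.1 hw.mem_fix.2 hk H⟩, ?_⟩
    · rw [hkw]
      exact s.incl_mem_nhd w' w'.2
    · rw [move, hkw, s.retr_incl w' w'.2]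
  · rintro ⟨h, hh, hw'⟩
    have hw := s.represents_toSector w
    have h1 : O.Represents s.chart s.elt (s.chart.1.act h (s.incl w)) (s.toSector w).1 :=
      hw.map_transition (s.chart.1.isTransition_actHomeo h) hw.mem_fix.1
        (s.chart.1.intertwines_actHomeo hw.mem_fix.1 (s.mem_centralizer.1 hh).2)
    rw [← s.incl_move hh w.2, hw'] at h1
    exact Subtype.ext (h1.unique (s.represents_toSector w'))

open Classical in
/-- The uniformizing system of the sector that is given by a slice. -/
def toChart : Chart d (O.sector t) where
  dom := s.dom
  isOpen_dom := s.isOpen_dom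
  isConnected_dom := s.isConnected_dom
  -- The image in the permutations of the slice is taken to make the action effective: `elt` itself,
  -- for instance, acts trivially.
  G := (MulAction.toPermHom s.centralizer s.dom).range
  finite := Finite.of_surjective _ (MonoidHom.rangeRestrict_surjective _)
  act σ w := if hw : w ∈ s.dom then (σ.1 ⟨w, hw⟩ : s.dom) else w
  act_mem σ w hw := by
    rw [dif_pos hw]
    exact Subtype.coe_prop _
  act_one w hw := by
    rw [dif_pos hw]
    rfl
  act_mul σ τ w hw := by
    simp only [dif_pos hw, Subtype.coe_prop, dite_true]
    rfl
  act_smooth σ := by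
    obtain ⟨h, hh⟩ := σ.2
    refine (s.contDiffOn_move h.2).congr fun w hw => ?_
    rw [dif_pos hw, ← hh]
    rfl
  act_effective σ hσ := by
    refine Subtype.ext (Equiv.ext fun w => Subtype.ext ?_)
    have h1 := hσ w w.2
    rwa [dif_pos w.2] at h1
  proj w := if hw : w ∈ s.dom then s.toSector ⟨w, hw⟩ else
      s.toSector ⟨s.isConnected_dom.nonempty.some, s.isConnected_dom.nonempty.some_mem⟩
  proj_continuous := by
    refine continuousOn_iff_continuous_domRestrict.2 ?_
    convert s.continuous_toSector using 1
    ext1 w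
    simp
  proj_open W hW hWo := by
    -- `retr` thickens `W` to an open set of `ℂⁿ` with the same trace on the fixed point set, so
    -- openness follows from that of images in `X̃`.
    have h1 : IsOpen (s.nhd ∩ s.retr ⁻¹' W) :=
      s.retr_smooth.continuousOn.isOpen_inter_preimage s.isOpen_nhd hWo
    convert (Orbifold.isOpen_image_represents s.chart s.elt h1).preimage
      (continuous_subtype_val : Continuous (Subtype.val : O.sector t → _)) using 1
    ext z
    constructor
    · rintro ⟨w, hw, rfl⟩
      refine ⟨s.incl w, ⟨s.incl_mem_nhd w (hW hw), ?_⟩, ?_⟩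
      · rwa [mem_preimage, s.retr_incl w (hW hw)]
      · dsimp only
        rw [dif_pos (hW hw)]
        exact s.represents_toSector ⟨w, hW hw⟩
    · rintro ⟨x, ⟨hx, hxW⟩, hz⟩
      refine ⟨s.retr x, hxW, ?_⟩
      dsimp only
      rw [dif_pos (hW hxW)]
      have h2 := s.represents_toSector ⟨s.retr x, hW hxW⟩
      dsimp only at h2
      rw [s.incl_retr x hx hz.mem_fix] at h2
      exact Subtype.ext (h2.unique hz)
  proj_eq_iff w hw w' hw' := by
    rw [dif_pos hw, dif_pos hw', s.toSector_eq_iff]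
    constructor
    · rintro ⟨h, hh, hww'⟩
      refine ⟨⟨_, ⟨h, hh⟩, rfl⟩, ?_⟩
      rw [dif_pos hw]
      exact hww'
    · rintro ⟨⟨_, h, rfl⟩, hσ⟩
      rw [dif_pos hw] at hσ
      exact ⟨h, h.2, hσ⟩

lemma exists_act_eq_move (σ : s.toChart.G) :
    ∃ h ∈ s.centralizer, ∀ w ∈ s.dom, s.toChart.act σ w = s.move h w := by
  obtain ⟨_, h, rfl⟩ := σ
  refine ⟨h, h.2, fun w hw => ?_⟩
  exact dif_pos hw

lemma represents_proj {w : Cn d} (hw : w ∈ s.dom) :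
    O.Represents s.chart s.elt (s.incl w) (s.toChart.proj w).1 := by
  have h1 : s.toChart.proj w = s.toSector ⟨w, hw⟩ := dif_pos hw
  rw [h1]
  exact s.represents_toSector ⟨w, hw⟩

end Slice

/-! ### The almost complex structure on slices and its invariance. -/

namespace Slice

variable {O : Orbifold n X} {t : O.T} {d : ℕ} (s s' : Slice O t d) (J : AlmostComplex O)

lemma contDiffAt_incl {w : Cn d} (hw : w ∈ s.dom) : ContDiffAt ℝ ∞ s.incl w :=
  s.incl_smooth.contDiffAt (s.isOpen_dom.mem_nhds hw)

lemma hasFDerivAt_incl {w : Cn d} (hw : w ∈ s.dom) :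
    HasFDerivAt s.incl (fderiv ℝ s.incl w) w :=
  ((s.contDiffAt_incl hw).differentiableAt (by simp)).hasFDerivAt

lemma hasFDerivAt_retr {y : Cn n} (hy : y ∈ s.nhd) :
    HasFDerivAt s.retr (fderiv ℝ s.retr y) y :=
  ((s.retr_smooth.contDiffAt (s.isOpen_nhd.mem_nhds hy)).differentiableAt
    (by simp)).hasFDerivAt

lemma fderiv_retr_fderiv_incl {w : Cn d} (hw : w ∈ s.dom) (v : Cn d) :
    fderiv ℝ s.retr (s.incl w) (fderiv ℝ s.incl w v) = v := by
  have h1 : HasFDerivAt (s.retr ∘ s.incl)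
      ((fderiv ℝ s.retr (s.incl w)).comp (fderiv ℝ s.incl w)) w :=
    (s.hasFDerivAt_retr (s.incl_mem_nhd w hw)).comp w (s.hasFDerivAt_incl hw)
  have h2 : s.retr ∘ s.incl =ᶠ[𝓝 w] id := by
    filter_upwards [s.isOpen_dom.mem_nhds hw] with y hy using s.retr_incl y hy
  exact congrArg (fun B : Cn d →L[ℝ] Cn d => B v)
    ((h2.hasFDerivAt_iff.1 h1).unique (hasFDerivAt_id w))

lemma fderiv_act_fderiv_incl {w : Cn d} (hw : w ∈ s.dom) (v : Cn d) :
    fderiv ℝ (s.chart.1.act s.elt) (s.incl w) (fderiv ℝ s.incl w v) = fderiv ℝ s.incl w v := by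
  have h1 : HasFDerivAt (s.chart.1.act s.elt ∘ s.incl)
      ((fderiv ℝ (s.chart.1.act s.elt) (s.incl w)).comp (fderiv ℝ s.incl w)) w :=
    (s.chart.1.differentiableAt_act s.elt (s.incl_mem_fix w hw).1).hasFDerivAt.comp w
      (s.hasFDerivAt_incl hw)
  have h2 : s.chart.1.act s.elt ∘ s.incl =ᶠ[𝓝 w] s.incl := by
    filter_upwards [s.isOpen_dom.mem_nhds hw] with y hy using (s.incl_mem_fix y hy).2
  exact congrArg (fun B : Cn d →L[ℝ] Cn n => B v)
    ((h2.hasFDerivAt_iff.1 h1).unique (s.hasFDerivAt_incl hw))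

/-- The almost complex structure of a slice, induced from the ambient one. -/
def slJ (w : Cn d) : Cn d →L[ℝ] Cn d :=
  (fderiv ℝ s.retr (s.incl w)).comp ((J.J s.chart (s.incl w)).comp (fderiv ℝ s.incl w))

/-- `J` commutes with the derivative of `elt`, so it preserves the vectors fixed by that derivative.
These are tangent to the slice, and on them `retr` loses nothing. -/
lemma fderiv_incl_slJ {w : Cn d} (hw : w ∈ s.dom) (v : Cn d) :
    fderiv ℝ s.incl w (s.slJ J w v) = J.J s.chart (s.incl w) (fderiv ℝ s.incl w v) := by
  refine s.fderiv_incl_fderiv_retr w hw (J.J s.chart (s.incl w) (fderiv ℝ s.incl w v)) ?_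
  rw [J.fderiv_act_comm (s.incl_mem_fix w hw), s.fderiv_act_fderiv_incl hw]

lemma fderiv_incl_injective {w : Cn d} (hw : w ∈ s.dom) :
    Function.Injective (fderiv ℝ s.incl w) :=
  Function.LeftInverse.injective (s.fderiv_retr_fderiv_incl hw)

lemma slJ_slJ {w : Cn d} (hw : w ∈ s.dom) (v : Cn d) : s.slJ J w (s.slJ J w v) = -v := by
  apply s.fderiv_incl_injective hw
  rw [s.fderiv_incl_slJ J hw, s.fderiv_incl_slJ J hw, J.sq _ _ (s.incl_mem_fix w hw).1, map_neg]

lemma contDiffOn_slJ : ContDiffOn ℝ ∞ (s.slJ J) s.dom := by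
  have h1 : ContDiffOn ℝ ∞ (fderiv ℝ s.incl) s.dom :=
    s.incl_smooth.fderiv_of_isOpen s.isOpen_dom (by simp)
  have h2 : ContDiffOn ℝ ∞ (fderiv ℝ s.retr) s.nhd :=
    s.retr_smooth.fderiv_of_isOpen s.isOpen_nhd (by simp)
  exact (h2.comp s.incl_smooth s.incl_mem_nhd).clm_comp
    (((J.smooth s.chart).comp s.incl_smooth fun w hw => (s.incl_mem_fix w hw).1).clm_comp h1)

variable {s s'} in
/-- A map between slices that is covered by a pseudo-holomorphic map is pseudo-holomorphic. -/
lemma fderiv_slJ_comm {F : Cn d → Cn d} {Φ : Cn n → Cn n} {w : Cn d} (hw : w ∈ s.dom)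
    (hw' : F w ∈ s'.dom) (hF : DifferentiableAt ℝ F w) (hΦ : DifferentiableAt ℝ Φ (s.incl w))
    (hFΦ : ∀ᶠ y in 𝓝 w, s'.incl (F y) = Φ (s.incl y))
    (hJ : ∀ v, fderiv ℝ Φ (s.incl w) (J.J s.chart (s.incl w) v) =
      J.J s'.chart (Φ (s.incl w)) (fderiv ℝ Φ (s.incl w) v)) (v : Cn d) :
    fderiv ℝ F w (s.slJ J w v) = s'.slJ J (F w) (fderiv ℝ F w v) := by
  have h1 : HasFDerivAt (s'.incl ∘ F) ((fderiv ℝ s'.incl (F w)).comp (fderiv ℝ F w)) w :=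
    (s'.hasFDerivAt_incl hw').comp w hF.hasFDerivAt
  have h2 : HasFDerivAt (Φ ∘ s.incl) ((fderiv ℝ Φ (s.incl w)).comp (fderiv ℝ s.incl w)) w :=
    hΦ.hasFDerivAt.comp w (s.hasFDerivAt_incl hw)
  have h3 : s'.incl ∘ F =ᶠ[𝓝 w] Φ ∘ s.incl := hFΦ
  have h4 : ∀ v, fderiv ℝ s'.incl (F w) (fderiv ℝ F w v) =
      fderiv ℝ Φ (s.incl w) (fderiv ℝ s.incl w v) := fun v =>
    congrArg (fun B : Cn d →L[ℝ] Cn n => B v) ((h3.hasFDerivAt_iff.1 h1).unique h2)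
  apply s'.fderiv_incl_injective hw'
  rw [h4, s.fderiv_incl_slJ J hw, hJ, s'.fderiv_incl_slJ J hw', h4, hFΦ.self_of_nhds]

lemma act_slJ_comm (σ : s.toChart.G) {w : Cn d} (hw : w ∈ s.dom) (v : Cn d) :
    fderiv ℝ (s.toChart.act σ) w (s.slJ J w v) =
      s.slJ J (s.toChart.act σ w) (fderiv ℝ (s.toChart.act σ) w v) := by
  obtain ⟨h, hh, hσ⟩ := s.exists_act_eq_move σ
  have hd := (s.incl_mem_fix w hw).1
  refine fderiv_slJ_comm J (Φ := s.chart.1.act h) hw (s.toChart.act_mem σ w hw)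
    (s.toChart.differentiableAt_act σ hw) (s.chart.1.differentiableAt_act h hd) ?_
    (J.act_comm s.chart h _ hd) v
  filter_upwards [s.isOpen_dom.mem_nhds hw] with y hy
  rw [hσ y hy, s.incl_move hh hy]

/-- Points of two slices over the same point of the sector are related by a pseudo-holomorphic change
of charts. -/
theorem exists_transition {w w' : Cn d} (hw : w ∈ s.dom) (hw' : w' ∈ s'.dom)
    (h : s.toChart.proj w = s'.toChart.proj w') :
    ∃ ψ, IsTransition s.toChart s'.toChart ψ ∧ w ∈ ψ.source ∧ ψ w = w' ∧
      ∀ u ∈ ψ.source, ∀ v, fderiv ℝ ψ u (s.slJ J u v) = s'.slJ J (ψ u) (fderiv ℝ ψ u v) := by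
  have hz := s.represents_proj hw
  have hz' := s'.represents_proj hw'
  rw [← h] at hz'
  obtain ⟨φ, hφ, hx, hφx, H⟩ := hz.exists_transition hz'
  have hg : s.chart.1.act s.elt (s.incl w) = s.incl w := (s.incl_mem_fix w hw).2
  -- A neighbourhood on which `φ` stays within both slice neighbourhoods and the intertwining
  -- relation persists at every point; there `retr ∘ φ ∘ incl` is the required change of charts.
  have hev : ∀ᶠ y in 𝓝 (s.incl w), y ∈ φ.source ∧ y ∈ s.nhd ∧ φ y ∈ s'.nhd ∧
      s.chart.1.act s.elt y ∈ φ.source ∧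
      ∀ᶠ y' in 𝓝 y, φ (s.chart.1.act s.elt y') = s'.chart.1.act s'.elt (φ y') := by
    refine (φ.open_source.eventually_mem hx).and
      ((s.isOpen_nhd.eventually_mem (s.incl_mem_nhd w hw)).and
      (((φ.continuousAt hx).eventually (s'.isOpen_nhd.eventually_mem
        (by rw [hφx]; exact s'.incl_mem_nhd w' hw'))).and
      (((s.chart.1.continuousAt_act s.elt (s.incl_mem_fix w hw).1).eventually
        (φ.open_source.eventually_mem (by rwa [hg]))).and (eventually_eventually_nhds.2 H))))
  obtain ⟨Q, hQ, hQo, hwQ⟩ := eventually_nhds_iff.1 hev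
  have hfix : ∀ y ∈ Q, y ∈ s.chart.1.fix s.elt → φ y ∈ s'.chart.1.fix s'.elt := fun y hy hyf =>
    ⟨hφ.map_mem (hQ y hy).1, Intertwines.act_apply (hQ y hy).2.2.2.2 hyf.2⟩
  -- Here `y` and its image under `elt` both lie in the source of `φ` and have the same image, so
  -- injectivity applies.
  have hfix' : ∀ y ∈ Q, φ y ∈ s'.chart.1.fix s'.elt → y ∈ s.chart.1.fix s.elt := by
    intro y hy hyf
    obtain ⟨h1, -, -, h2, h3⟩ := hQ y hy
    refine ⟨hφ.mem_dom h1, φ.injOn h2 h1 ?_⟩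
    rw [h3.self_of_nhds, hyf.2]
  have hQs : Q ⊆ φ.source := fun y hy => (hQ y hy).1
  have hQt : IsOpen (φ '' Q) := φ.isOpen_image_of_subset_source hQo hQs
  have hin : ∀ u ∈ s.dom ∩ s.incl ⁻¹' Q,
      s'.retr (φ (s.incl u)) ∈ s'.dom ∧
        s'.incl (s'.retr (φ (s.incl u))) = φ (s.incl u) := by
    rintro u ⟨hu, huQ⟩
    have h1 := hfix _ huQ (s.incl_mem_fix u hu)
    have h2 := (hQ _ huQ).2.2.1
    exact ⟨s'.retr_mem _ h2 h1, s'.incl_retr _ h2 h1⟩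
  have hin' : ∀ u ∈ s'.dom ∩ s'.incl ⁻¹' (φ '' Q), φ.symm (s'.incl u) ∈ Q ∧
      φ (φ.symm (s'.incl u)) = s'.incl u ∧ s.retr (φ.symm (s'.incl u)) ∈ s.dom ∧
        s.incl (s.retr (φ.symm (s'.incl u))) = φ.symm (s'.incl u) := by
    rintro u ⟨hu, y, hyQ, hy⟩
    have h1 := s'.incl_mem_fix u hu
    rw [← hy] at h1
    have h2 := hfix' y hyQ h1
    have h3 := (hQ y hyQ).2.1
    rw [← hy, φ.left_inv (hQs hyQ)]
    exact ⟨hyQ, rfl, s.retr_mem _ h3 h2, s.incl_retr _ h3 h2⟩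
  have hsm : ContDiffOn ℝ ∞ (fun u => s'.retr (φ (s.incl u))) (s.dom ∩ s.incl ⁻¹' Q) :=
    s'.retr_smooth.comp ((hφ.smooth.comp (s.incl_smooth.mono inter_subset_left)
      fun u hu => hQs hu.2)) fun u hu => (hQ _ hu.2).2.2.1
  have hsm' : ContDiffOn ℝ ∞ (fun u => s.retr (φ.symm (s'.incl u)))
      (s'.dom ∩ s'.incl ⁻¹' (φ '' Q)) := by
    refine s.retr_smooth.comp ((hφ.smooth_symm.comp (s'.incl_smooth.mono inter_subset_left)
      fun u hu => ?_)) fun u hu => (hQ _ (hin' u hu).1).2.1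
    obtain ⟨y, hy, hyu⟩ := hu.2
    rw [← hyu]
    exact φ.map_source (hQs hy)
  let ψ : OpenPartialHomeomorph (Cn d) (Cn d) :=
    { toFun := fun u => s'.retr (φ (s.incl u))
      invFun := fun u => s.retr (φ.symm (s'.incl u))
      source := s.dom ∩ s.incl ⁻¹' Q
      target := s'.dom ∩ s'.incl ⁻¹' (φ '' Q)
      map_source' := fun u hu => by
        refine ⟨(hin u hu).1, ?_⟩
        rw [mem_preimage, (hin u hu).2]
        exact mem_image_of_mem _ hu.2
      map_target' := fun u hu => by
        refine ⟨(hin' u hu).2.2.1, ?_⟩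
        rw [mem_preimage, (hin' u hu).2.2.2]
        exact (hin' u hu).1
      left_inv' := fun u hu => by
        rw [(hin u hu).2, φ.left_inv (hQs hu.2), s.retr_incl u hu.1]
      right_inv' := fun u hu => by
        rw [(hin' u hu).2.2.2, (hin' u hu).2.1, s'.retr_incl u hu.1]
      open_source := s.incl_smooth.continuousOn.isOpen_inter_preimage s.isOpen_dom hQo
      open_target := s'.incl_smooth.continuousOn.isOpen_inter_preimage s'.isOpen_dom hQt
      continuousOn_toFun := hsm.continuousOn
      continuousOn_invFun := hsm'.continuousOn }
  have hψ : IsTransition s.toChart s'.toChart ψ :=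
    { source_subset := inter_subset_left
      target_subset := inter_subset_left
      smooth := hsm
      smooth_symm := hsm'
      proj_eq := fun u hu => by
        have h1 := s.represents_proj hu.1
        have h2 := s'.represents_proj (hin u hu).1
        rw [(hin u hu).2] at h2
        exact Subtype.ext
          (h2.unique (h1.map_transition hφ (hQs hu.2) (hQ _ hu.2).2.2.2.2)) }
  refine ⟨ψ, hψ, ⟨hw, hwQ⟩, ?_, fun u hu v => ?_⟩
  · change s'.retr (φ (s.incl w)) = w'
    rw [hφx, s'.retr_incl w' hw']
  · refine fderiv_slJ_comm J (Φ := φ) hu.1 (hψ.map_mem hu) (hψ.differentiableAt hu)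
      (hφ.differentiableAt (hQs hu.2)) ?_ (J.transition_comm _ _ φ hφ _ (hQs hu.2)) v
    filter_upwards [ψ.open_source.mem_nhds hu] with y hy using (hin y hy).2

/-- Every change of charts between slices is pseudo-holomorphic. -/
theorem transition_slJ_comm {φ : OpenPartialHomeomorph (Cn d) (Cn d)}
    (hφ : IsTransition s.toChart s'.toChart φ) {w : Cn d} (hw : w ∈ φ.source) (v : Cn d) :
    fderiv ℝ φ w (s.slJ J w v) = s'.slJ J (φ w) (fderiv ℝ φ w v) := by
  obtain ⟨ψ, hψ, hwψ, hψw, hJ⟩ := s.exists_transition s' J (hφ.mem_dom hw) (hφ.map_mem hw)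
    (hφ.proj_eq w hw).symm
  -- An arbitrary change of charts differs locally from the constructed `ψ` by a group element, and
  -- both factors are pseudo-holomorphic.
  obtain ⟨k, hk⟩ := hφ.exists_eventuallyEq_act_comp hψ hw hwψ
  have hd := hψ.map_mem hwψ
  have h1 : HasFDerivAt (s'.toChart.act k ∘ ψ)
      ((fderiv ℝ (s'.toChart.act k) (ψ w)).comp (fderiv ℝ ψ w)) w :=
    (s'.toChart.differentiableAt_act k hd).hasFDerivAt.comp w
      (hψ.differentiableAt hwψ).hasFDerivAt
  have h2 : φ =ᶠ[𝓝 w] s'.toChart.act k ∘ ψ := hk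
  rw [h2.fderiv_eq (𝕜 := ℝ), h1.fderiv, hk.self_of_nhds, ContinuousLinearMap.comp_apply,
    ContinuousLinearMap.comp_apply, hJ w hwψ, s'.act_slJ_comm J k hd]

end Slice

/-! ### The orbifold structure on a sector. -/

namespace AlmostComplex

variable {O : Orbifold n X} (J : AlmostComplex O)

/-- The orbifold structure of a sector. -/
def sectorOrbifold [CompactSpace X] {t : O.T} {d : ℕ} (hd : ∀ z ∈ O.sector t, J.fixDim z = d) :
    Orbifold d (O.sector t) where
  t2 := inferInstance
  secondCountable := inferInstance
  atlas := range Slice.toChart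
  cover z := by
    obtain ⟨z, rfl⟩ := z
    -- Substitution, not rewriting, since the dimension indexes the type of the slices.
    obtain rfl : J.fixDim z = d := hd z rfl
    obtain ⟨s, w, hw, hz⟩ := J.exists_slice z
    exact ⟨⟨s.toChart, s, rfl⟩, w, hw, Subtype.ext ((s.represents_proj hw).unique hz)⟩
  compatible := by
    rintro ⟨_, s, rfl⟩ ⟨_, s', rfl⟩ w hw w' hw' h
    obtain ⟨ψ, hψ, hwψ, hψw, -⟩ := s.exists_transition s' J hw hw' h
    exact ⟨ψ, hψ, hwψ, hψw⟩

/-- Each chart of the sector comes from a slice, so the local identification with a fixed point set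
can be taken on its whole domain, with `incl` and `retr` as the two maps. -/
theorem exists_isNatural [CompactSpace X] {t : O.T} {d : ℕ}
    (hd : ∀ z ∈ O.sector t, J.fixDim z = d) :
    ∃ (O' : Orbifold d (O.sector t)) (J' : AlmostComplex O'), J.IsNatural J' := by
  have hs : ∀ c : (J.sectorOrbifold hd).atlas, ∃ s : Slice O t d, c.1 = s.toChart :=
    fun ⟨_, s, h⟩ => ⟨s, h.symm⟩
  choose s hs using hs
  refine ⟨J.sectorOrbifold hd,
    { J := fun c => (s c).slJ J
      smooth := fun c => ?_
      sq := fun c => ?_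
      act_comm := fun c => ?_
      transition_comm := fun c c' => ?_ }, fun c w hw => ?_⟩
  · rw [hs c]
    exact (s c).contDiffOn_slJ J
  · rw [hs c]
    exact fun w hw => (s c).slJ_slJ J hw
  · rw [hs c]
    exact fun σ w hw => (s c).act_slJ_comm J σ hw
  · rw [hs c, hs c']
    exact fun φ hφ w hw => (s c).transition_slJ_comm (s c') J hφ hw
  · rw [hs c] at hw ⊢
    refine ⟨(s c).chart, (s c).elt, (s c).dom, (s c).nhd, (s c).incl, (s c).retr,
      (s c).isOpen_dom, hw, Subset.rfl, (s c).isOpen_nhd, (s c).incl_smooth, (s c).retr_smooth,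
      fun u hu => ⟨(s c).incl_mem_nhd u hu, (s c).incl_mem_fix u hu⟩,
      fun y hy => (s c).retr_mem y hy.1 hy.2, (s c).retr_incl,
      fun y hy => (s c).incl_retr y hy.1 hy.2, fun u hu => (s c).fderiv_incl_slJ J hu,
      fun u hu => (s c).represents_proj hu⟩

end AlmostComplex

end CROrbifold

end

/-! ### The main theorem. -/

open CROrbifold in
theorem lemma2p1 {n : ℕ} {X : Type u} [TopologicalSpace X] [CompactSpace X]
    (O : Orbifold n X) (J : AlmostComplex O) :
    -- the sectors are pairwise disjoint open sets that cover `X̃`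
    (⋃ t, O.sector t) = Set.univ ∧
    (∀ t t', t ≠ t' → Disjoint (O.sector t) (O.sector t')) ∧
    (∀ t, IsOpen (O.sector t)) ∧
    -- the dimensions of the sectors, the values of `ι` on them, and the involution of `T`
    ∃ (dimT : O.T → ℕ) (shiftT : O.T → ℚ) (invT : O.T → O.T),
      (∀ t, CompactSpace (O.sector t) ∧ ConnectedSpace (O.sector t) ∧
        ∃ (O' : Orbifold (dimT t) (O.sector t)) (J' : AlmostComplex O'), J.IsNatural J') ∧
      (∀ z, J.shift z = shiftT (O.toT z)) ∧
      (∀ z, O.toT (O.invol z) = invT (O.toT z)) ∧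
      ((∀ z, ∃ k : ℤ, J.shift z = k) ↔
        ∀ p, ∀ g : O.localGroup p, LinearMap.det (J.isotropy p g) = 1) ∧
      (∀ t, shiftT t + shiftT (invT t) = (n : ℚ) - (dimT t : ℚ)) ∧
      (∀ t, 0 ≤ shiftT t) ∧
      (∀ t, shiftT t = 0 ↔ ∃ p, t = O.toT (O.trivialPt p)) ∧
      -- the classes `(1)` correspond to the components of `X`: there is just one if `X` is connected
      (∀ p q, O.toT (O.trivialPt p) = O.toT (O.trivialPt q) ↔
        connectedComponent p = connectedComponent q) := by
  -- The functions on `T` are values at chosen representatives; invariance under elementary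
  -- equivalence makes the choice immaterial.
  choose rep hrep using Orbifold.exists_toT_eq (O := O)
  have hdim : ∀ z, J.fixDim z = J.fixDim (rep (O.toT z)) := fun z =>
    Orbifold.apply_eq_of_toT_eq J.fixDim (fun _ _ => J.fixDim_eq_of_adjacent) (hrep _).symm
  have hshift : ∀ z, J.shift z = J.shift (rep (O.toT z)) := fun z =>
    Orbifold.apply_eq_of_toT_eq J.shift (fun _ _ => J.shift_eq_of_adjacent) (hrep _).symm
  have hinv : ∀ z, O.toT (O.invol z) = O.toT (O.invol (rep (O.toT z))) := fun z =>
    Orbifold.apply_eq_of_toT_eq (fun z => O.toT (O.invol z)) (fun _ _ h => h.invol.toT_eq)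
      (hrep _).symm
  refine ⟨eq_univ_of_forall fun z => mem_iUnion.2 ⟨O.toT z, rfl⟩, fun t t' htt' => ?_,
    Orbifold.isOpen_sector, fun t => J.fixDim (rep t), fun t => J.shift (rep t),
    fun t => O.toT (O.invol (rep t)), fun t => ⟨?_, ?_, ?_⟩, hshift, hinv, J.shift_isInt_iff,
    fun t => ?_, fun t => J.shift_nonneg _, fun t => ?_, Orbifold.toT_trivialPt_eq_iff⟩
  · exact Set.disjoint_left.2 fun z hz hz' => htt' (Eq.trans (Eq.symm hz) hz')
  · exact isCompact_iff_compactSpace.1 (Orbifold.isClosed_sector t).isCompact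
  · exact isConnected_iff_connectedSpace.1 (Orbifold.isConnected_sector t)
  · refine J.exists_isNatural fun z hz => ?_
    rw [hdim z, show O.toT z = t from hz]
  · dsimp only
    rw [← hshift, J.shift_add_shift_invol]
  · rw [J.shift_eq_zero_iff]
    constructor
    · intro h
      exact ⟨_, by rw [← h, hrep]⟩
    · rintro ⟨p, hp⟩
      -- The representative need not be `(p, (1))`, but the shift is constant on the sector and can
      -- be evaluated there.
      rw [← J.shift_eq_zero_iff, hp, ← hshift, J.shift_eq_zero_iff]
      rfl
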